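/- **Setting.** Let $f,g\in\mathcal C^2(\mathbb R)$ and suppose that, for some $c_0>0$, $g(s)-f(s)\ge c_0$ for all $s\in\mathbb R$. Consider the conservation law with gradient-dependent flux $u_t+[\bar\theta(u_x)f(u)+(1-\bar\theta(u_x))g(u)]_x=0$, where $\bar\theta(s)=1$ for $s>0$ and $\bar\theta(s)=0$ for $s<0$. For an integer $\nu\ge1$ let $f_\nu,g_\nu$ be the piecewise affine functions that coincide with $f,g$ at the points $2^{-\nu}j$, $j\in\mathbb Z$, and are affine between consecutive such points. A *front tracking solution* (for $f,g,\nu$) is a function $u:[0,\infty)\times\mathbb R\to\mathbb R$ for which there are times $0=\tau_0<\tau_1<\tau_2<\cdots$, $\tau_k\to\infty$ (the restarting times; times at which nothing happens may be listed too), such that on each $[\tau_k,\tau_{k+1}]$ there are an integer $n\ge0$, continuous fronts $x_1(t)\le\dots\le x_n(t)$ and continuous states $\widehat u_0(t),\dots,\widehat u_n(t)$ with $\widehat u_0=\widehat u_n=0$, $$u(t,x)=\widehat u_i(t)\quad\text{for } x_i(t)\le x<x_{i+1}(t)\qquad(x_0=-\infty,\ x_{n+1}=+\infty),$$ and the following holds.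 * $x_1(t)<\dots<x_n(t)$ for $\tau_k<t<\tau_{k+1}$, and $\widehat u_{i-1}(t)\ne\widehat u_i(t)$ for $\tau_k\le t<\tau_{k+1}$, $1\le i\le n$. * At time $\tau_k$ each jump is resolved by a monotone fan: if $x_i(\tau_k)=x_{i+1}(\tau_k)$, then $\widehat u_i(\tau_k)$ lies strictly between $\widehat u_{i-1}(\tau_k)$ and $\widehat u_{i+1}(\tau_k)$. * Let $\phi=f_\nu$ if $\widehat u_{i-1}(t)<\widehat u_i(t)$ and $\phi=g_\nu$ if $\widehat u_{i-1}(t)>\widehat u_i(t)$. For $\tau_k\le t<\tau_{k+1}$ the $i$-th jump is Liu admissible, $$\frac{\phi(c)-\phi(\widehat u_{i-1})}{c-\widehat u_{i-1}}\ \ge\ \frac{\phi(\widehat u_i)-\phi(\widehat u_{i-1})}{\widehat u_i-\widehat u_{i-1}}\quad\text{for all } c\ne\widehat u_{i-1}\text{ between }\widehat u_{i-1}\text{ and }\widehat u_i,$$ and for $\tau_k<t<\tau_{k+1}$ the front moves with the speed $\dot x_i=\dfrac{\phi(\widehat u_i)-\phi(\widehat u_{i-1})}{\widehat u_i-\widehat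 u_{i-1}}$. * For $1\le i\le n-1$ and $\tau_k<t<\tau_{k+1}$: $$\frac{d}{dt}\widehat u_i=\begin{cases}\dfrac{f_\nu(\widehat u_i)-g_\nu(\widehat u_i)}{x_{i+1}-x_i}&\text{if }\widehat u_i>\max\{\widehat u_{i-1},\widehat u_{i+1}\},\\[2mm] \dfrac{g_\nu(\widehat u_i)-f_\nu(\widehat u_i)}{x_{i+1}-x_i}&\text{if }\widehat u_i<\min\{\widehat u_{i-1},\widehat u_{i+1}\},\\[2mm] 0&\text{otherwise.}\end{cases}$$ **Proposition 2.1.** Let $f,g,c_0,\nu$ be as above, and let $u_\nu,v_\nu$ be two front tracking solutions for the same $f,g,\nu$. Then: 1. the norm $t\mapsto\|u_\nu(t,\cdot)\|_{\mathbf L^1(\mathbb R)}$ is non-increasing on $[0,\infty)$; 2. the maps $t\mapsto\mathrm{Tot.Var.}\{u_\nu(t,\cdot)\}$ and $t\mapsto\|u_\nu(t,\cdot)\|_{\mathbf L^\infty}$ are non-increasing on $[0,\infty)$; 3. (comparison) if $u_\nu(0,x)\le v_\nu(0,x)$ for all $x\in\mathbb R$, then $u_\nu(t,x)\le v_\nu(t,x)$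 for all $t\ge0$ and $x\in\mathbb R$; 4. the distance $t\mapsto\|u_\nu(t)-v_\nu(t)\|_{\mathbf L^1(\mathbb R)}$ is non-increasing on $[0,\infty)$; in particular $\|u_\nu(t)-v_\nu(t)\|_{\mathbf L^1}\le\|u_\nu(0)-v_\nu(0)\|_{\mathbf L^1}$ for all $t>0$. -/

import Mathlib

namespace FrontTracking

open Set Filter

/-- The piecewise affine interpolation `φ_ν` of `φ` at the grid points `2^{-ν} j`, `j ∈ ℤ`.
With `u_j = 2^{-ν} j` and `u ∈ [u_j, u_{j+1})` its value is
`2^ν ((u - u_j) φ(u_{j+1}) + (u_{j+1} - u) φ(u_j))`. -/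
noncomputable def pwAffine (ν : ℕ) (φ : ℝ → ℝ) (u : ℝ) : ℝ :=
  let j : ℤ := ⌊(2 : ℝ) ^ ν * u⌋
  let a : ℝ := (j : ℝ) / 2 ^ ν
  let b : ℝ := ((j : ℝ) + 1) / 2 ^ ν
  2 ^ ν * ((u - a) * φ b + (b - u) * φ a)

/-- The flux that governs a jump from the left state `a` to the right state `b`:
`F` for an upward jump and `G` for a downward jump. -/
noncomputable def jumpFlux (F G : ℝ → ℝ) (a b : ℝ) : ℝ → ℝ :=
  if a < b then F else G

/-- The Rankine-Hugoniot speed of a jump with left state `a` and right state `b`. -/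
noncomputable def rhSpeed (φ : ℝ → ℝ) (a b : ℝ) : ℝ :=
  (φ b - φ a) / (b - a)

/-- The Liu admissibility condition for a jump with left state `a` and right state `b`. -/
def LiuAdmissible (φ : ℝ → ℝ) (a b : ℝ) : Prop :=
  ∀ c ∈ uIcc a b, c ≠ a → rhSpeed φ a b ≤ rhSpeed φ a c

/-- The time derivative of the state `m` on a bounded interval of length `len`, when the
neighbouring states are `l` on the left and `r` on the right: a sink at a local maximum, a source
at a local minimum, and `0` otherwise. -/
noncomputable def plateauRate (F G : ℝ → ℝ) (l m r len : ℝ) : ℝ :=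
  if max l r < m then (F m - G m) / len
  else if m < min l r then (G m - F m) / len
  else 0

/-- The right-continuous step function with the jump points `x 0 ≤ x 1 ≤ ... ≤ x (n - 1)` and the
states `w 0, ..., w n`: the value is `w 0` on the left of all jump points, and
`w (i + 1)` on `[x i, x (i + 1))`. -/
noncomputable def stepFunction (n : ℕ) (x w : ℕ → ℝ) (y : ℝ) : ℝ :=
  w ((Finset.range n).filter (fun i => x i ≤ y)).card

/-- One run of the algorithm between two consecutive restarting times `a < b`, with the fluxes `F`
(upward jumps) and `G` (downward jumps). There are `n` fronts, at the positions
`x 0 t < x 1 t < ... < x (n - 1) t`; the states are `w 0 t, ..., w n t`, and the front `x i` has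
left state `w i` and right state `w (i + 1)`. -/
structure IsFrontRun (F G : ℝ → ℝ) (a b : ℝ) (n : ℕ) (x w : ℕ → ℝ → ℝ) : Prop where
  /-- The solution vanishes near `-∞`. -/
  left_zero : ∀ t ∈ Icc a b, w 0 t = 0
  /-- The solution vanishes near `+∞`. -/
  right_zero : ∀ t ∈ Icc a b, w n t = 0
  cont_front : ∀ i < n, ContinuousOn (x i) (Icc a b)
  cont_state : ∀ i ≤ n, ContinuousOn (w i) (Icc a b)
  /-- The fronts do not meet inside the run. -/
  front_lt : ∀ i, i + 1 < n → ∀ t ∈ Ioo a b, x i t < x (i + 1) t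
  /-- At the initial time of the run every jump is resolved by a monotone fan: a state between two
  fronts that start from the same point lies strictly between the two neighbouring states. -/
  fan : ∀ i, i + 1 < n → x i a = x (i + 1) a →
    (w i a < w (i + 1) a ∧ w (i + 1) a < w (i + 2) a) ∨
      (w (i + 2) a < w (i + 1) a ∧ w (i + 1) a < w i a)
  /-- No jump vanishes before the final time of the run. -/
  jump_ne : ∀ i < n, ∀ t ∈ Ico a b, w i t ≠ w (i + 1) t
  /-- All jumps are Liu admissible, for the flux selected by the sign of the jump. -/
  liu : ∀ i < n, ∀ t ∈ Ico a b,
    LiuAdmissible (jumpFlux F G (w i t) (w (i + 1) t)) (w i t) (w (i + 1) t)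
  /-- Every front travels with its Rankine-Hugoniot speed. -/
  front_deriv : ∀ i < n, ∀ t ∈ Ioo a b,
    HasDerivAt (x i)
      (rhSpeed (jumpFlux F G (w i t) (w (i + 1) t)) (w i t) (w (i + 1) t)) t
  /-- The states on the bounded intervals: constant unless they are a local maximum or a local
  minimum, where they follow the ordinary differential equation of the sink or of the source. -/
  state_deriv : ∀ i, i + 1 < n → ∀ t ∈ Ioo a b,
    HasDerivAt (w (i + 1))
      (plateauRate F G (w i t) (w (i + 1) t) (w (i + 2) t) (x (i + 1) t - x i t)) t

/-- `u` (a function of the time `t ≥ 0` and of the position) is a front tracking solution, with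
parameter `ν`, of the conservation law with flux `f` where the solution increases and flux `g` where
it decreases. It is obtained by runs of the algorithm with the fluxes `f_ν`, `g_ν`, over the
intervals between consecutive restarting times `0 = τ 0 < τ 1 < τ 2 < ...`, which do not accumulate.
At a restarting time the profile left by one run is the initial profile of the next one.
(Times at which nothing happens are allowed among the `τ k`, so that the case of finitely many
restartings is included.) The initial profile `u 0` is an arbitrary piecewise constant integrable
function, and every profile is the right-continuous representative. -/
def IsFrontTrackingSolution (ν : ℕ) (f g : ℝ → ℝ) (u : ℝ → ℝ → ℝ) : Prop :=
  ∃ τ : ℕ → ℝ, τ 0 = 0 ∧ StrictMono τ ∧ Tendsto τ atTop atTop ∧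
    ∀ k : ℕ, ∃ (n : ℕ) (x w : ℕ → ℝ → ℝ),
      IsFrontRun (pwAffine ν f) (pwAffine ν g) (τ k) (τ (k + 1)) n x w ∧
        ∀ t ∈ Icc (τ k) (τ (k + 1)), ∀ y : ℝ,
          u t y = stepFunction n (fun i => x i t) (fun i => w i t) y

end FrontTracking

/-!
The equation is formally `u_t = (A(u, u_x))_x` with `A` nondecreasing in `u_x`, because `f ≤ g`.
This is why it contracts the one-sided distance `∫ (u - v)⁺`, and the `L¹`, `L^∞` and comparison
claims all follow from this contraction (`IsFrontSolution.antitoneOn_integral`): the `L¹` distance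
is the sum of the two one-sided distances, the `L¹` norm is the distance to the solution `0`, and
the `L^∞` norm is controlled by comparison with constants. For the last point the contraction is
proved for a class that contains all constants (`IsFrontSolution`).

For the contraction, give each plateau of a front configuration a flux that is affine in the
position, so that the balance law holds inside the plateau and the Rankine-Hugoniot condition holds
at its ends (`IsFluxProfile`). The value of this flux always lies between `F(w)` and `G(w)`, where
`w` is the state. Merge the fronts of `u` and of `v` into one list, in which each merged front
changes only one of the two states. The integral `∫ (u - v)⁺` is then a finite sum (`shuffleSum`).
With factors `c` from the Heaviside graph of `u - v`, Liu admissibility bounds the contribution of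
each merged front to the time derivative by the jump of `c (flux of u - flux of v)`
(`jump_first_le`, `jump_second_le`), and these bounds telescope to `0` (`shuffleSum_rate_nonpos`).
The fronts of `u` and `v` may coincide and cross in an arbitrary way. This is harmless: only
finitely many merged orders occur, and the estimate holds for every order that is sorted at the
given time, so that the right derivative of the excess is nonpositive (`antitoneOn_excess`).

The total variation is the sum of the jumps `∑ |w (i + 1) - w i|`, which decreases because local
maxima sink and local minima rise. Fronts that coincide at the end of a run can only make the total
variation smaller than this sum, and at the beginning of a run the monotone fans make the two equal
(`le_eVariationOn_stepFunction`).
-/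

namespace FrontTracking

open Set Filter Topology MeasureTheory

/-! ### The fluxes and the admissible jumps -/

lemma pwAffine_mono {f g : ℝ → ℝ} (hfg : ∀ s, f s ≤ g s) (ν : ℕ) (s : ℝ) :
    pwAffine ν f s ≤ pwAffine ν g s := by
  have h2 : (0 : ℝ) < 2 ^ ν := by positivity
  have h1 := Int.floor_le ((2 : ℝ) ^ ν * s)
  have h3 := (Int.lt_floor_add_one ((2 : ℝ) ^ ν * s)).le
  have ha : (⌊(2 : ℝ) ^ ν * s⌋ : ℝ) / 2 ^ ν ≤ s := by
    rw [div_le_iff₀ h2]; linarith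
  have hb : s ≤ ((⌊(2 : ℝ) ^ ν * s⌋ : ℝ) + 1) / 2 ^ ν := by
    rw [le_div_iff₀ h2]; linarith
  unfold pwAffine
  dsimp only
  have := hfg ((⌊(2 : ℝ) ^ ν * s⌋ : ℝ) / 2 ^ ν)
  have := hfg (((⌊(2 : ℝ) ^ ν * s⌋ : ℝ) + 1) / 2 ^ ν)
  gcongr

section Jump

variable {F G : ℝ → ℝ} {a b z θ c c' : ℝ}

lemma jumpFlux_of_lt (h : a < b) : jumpFlux F G a b = F := if_pos h

lemma jumpFlux_of_gt (h : b < a) : jumpFlux F G a b = G := if_neg h.le.not_gt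

lemma jumpFlux_apply_le (hFG : ∀ s, F s ≤ G s) (s : ℝ) : jumpFlux F G a b s ≤ G s := by
  unfold jumpFlux; split_ifs
  exacts [hFG s, le_rfl]

lemma le_jumpFlux_apply (hFG : ∀ s, F s ≤ G s) (s : ℝ) : F s ≤ jumpFlux F G a b s := by
  unfold jumpFlux; split_ifs
  exacts [le_rfl, hFG s]

lemma rhSpeed_mul (φ : ℝ → ℝ) (h : a ≠ b) : rhSpeed φ a b * (b - a) = φ b - φ a :=
  div_mul_cancel₀ _ (sub_ne_zero.2 h.symm)

/-- Across an admissible upward jump the flux lies above its chord. -/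
lemma LiuAdmissible.chord_le {φ : ℝ → ℝ} (h : LiuAdmissible φ a b) (hz : a ≤ z) (hzb : z ≤ b) :
    φ a + rhSpeed φ a b * (z - a) ≤ φ z := by
  rcases hz.eq_or_lt with rfl | hz
  · simp
  · have h1 := h z (mem_uIcc_of_le hz.le hzb) hz.ne'
    have h2 := mul_le_mul_of_nonneg_right h1 (sub_pos.2 hz).le
    rw [rhSpeed_mul φ hz.ne] at h2
    linarith

/-- Across an admissible downward jump the flux lies below its chord. -/
lemma LiuAdmissible.le_chord {φ : ℝ → ℝ} (h : LiuAdmissible φ a b) (hz : z ≤ a) (hzb : b ≤ z) :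
    φ z ≤ φ a + rhSpeed φ a b * (z - a) := by
  rcases hz.eq_or_lt with rfl | hz
  · simp
  · have h1 := h z (mem_uIcc_of_ge hzb hz.le) hz.ne
    have h2 := mul_le_mul_of_nonpos_right h1 (sub_neg.2 hz).le
    rw [rhSpeed_mul φ hz.ne'] at h2
    linarith

/-- `c` is a value of the Heaviside graph at `s`; at `s = 0` both `0` and `1` are allowed. -/
def IsHeaviside (c s : ℝ) : Prop :=
  (0 < s ∧ c = 1) ∨ (s < 0 ∧ c = 0) ∨ (s = 0 ∧ (c = 0 ∨ c = 1))

/-- The contribution to the rate of `∫ (u - v)⁺` of a jump of `u` from `a` to `b`, at a position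
where `v` has the state `z` and the flux `θ`. -/
lemma jump_first_le (hab : a ≠ b) (hliu : LiuAdmissible (jumpFlux F G a b) a b)
    (h1 : F z ≤ θ) (h2 : θ ≤ G z) (hc : IsHeaviside c (a - z)) (hc' : IsHeaviside c' (b - z)) :
    rhSpeed (jumpFlux F G a b) a b * (max (a - z) 0 - max (b - z) 0) ≤
      c * (jumpFlux F G a b a - θ) - c' * (jumpFlux F G a b b - θ) := by
  have hsp := rhSpeed_mul (jumpFlux F G a b) hab
  rcases lt_or_gt_of_ne hab with h | h
  · rw [jumpFlux_of_lt h] at *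
    have hch := fun h1 h2 => hliu.chord_le (z := z) h1 h2
    rcases hc with ⟨hs, rfl⟩ | ⟨hs, rfl⟩ | ⟨hs, rfl | rfl⟩ <;>
    rcases hc' with ⟨hs', rfl⟩ | ⟨hs', rfl⟩ | ⟨hs', rfl | rfl⟩ <;>
    first
    | (exfalso; linarith)
    | (have hch := hch (by linarith) (by linarith)
       first
       | rw [max_eq_left (by linarith), max_eq_left (by linarith)]; nlinarith
       | rw [max_eq_right (by linarith), max_eq_left (by linarith)]; nlinarith)
    | (rw [max_eq_left (by linarith), max_eq_left (by linarith)]; nlinarith)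
    | (rw [max_eq_right (by linarith), max_eq_right (by linarith)]; nlinarith)
  · rw [jumpFlux_of_gt h] at *
    have hch := fun h1 h2 => hliu.le_chord (z := z) h1 h2
    rcases hc with ⟨hs, rfl⟩ | ⟨hs, rfl⟩ | ⟨hs, rfl | rfl⟩ <;>
    rcases hc' with ⟨hs', rfl⟩ | ⟨hs', rfl⟩ | ⟨hs', rfl | rfl⟩ <;>
    first
    | (exfalso; linarith)
    | (have hch := hch (by linarith) (by linarith)
       first
       | rw [max_eq_left (by linarith), max_eq_left (by linarith)]; nlinarith
       | rw [max_eq_left (by linarith), max_eq_right (by linarith)]; nlinarith)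
    | (rw [max_eq_left (by linarith), max_eq_left (by linarith)]; nlinarith)
    | (rw [max_eq_right (by linarith), max_eq_right (by linarith)]; nlinarith)

/-- The contribution to the rate of `∫ (u - v)⁺` of a jump of `v` from `a` to `b`, at a position
where `u` has the state `z` and the flux `θ`. -/
lemma jump_second_le (hab : a ≠ b) (hliu : LiuAdmissible (jumpFlux F G a b) a b)
    (h1 : F z ≤ θ) (h2 : θ ≤ G z) (hc : IsHeaviside c (z - a)) (hc' : IsHeaviside c' (z - b)) :
    rhSpeed (jumpFlux F G a b) a b * (max (z - a) 0 - max (z - b) 0) ≤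
      c * (θ - jumpFlux F G a b a) - c' * (θ - jumpFlux F G a b b) := by
  have hsp := rhSpeed_mul (jumpFlux F G a b) hab
  -- `s⁺ = s + (-s)⁺` reduces the claim to `jump_first_le`; the linear part is Rankine-Hugoniot.
  have key : ∀ s : ℝ, max s 0 = s + max (-s) 0 := by
    intro s; rcases le_total s 0 with h | h
    · rw [max_eq_right h, max_eq_left (by linarith)]; ring
    · rw [max_eq_left h, max_eq_right (by linarith)]; ring
  have flip : ∀ {c s : ℝ}, IsHeaviside c s → IsHeaviside (1 - c) (-s) := by
    rintro c s (⟨hs, rfl⟩ | ⟨hs, rfl⟩ | ⟨hs, rfl | rfl⟩)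
    · exact Or.inr (Or.inl ⟨by linarith, by norm_num⟩)
    · exact Or.inl ⟨by linarith, by norm_num⟩
    · exact Or.inr (Or.inr ⟨by linarith, by norm_num⟩)
    · exact Or.inr (Or.inr ⟨by linarith, by norm_num⟩)
  have hc1 := flip hc
  have hc2 := flip hc'
  rw [neg_sub] at hc1 hc2
  have := jump_first_le hab hliu h1 h2 hc1 hc2
  rw [key (z - a), key (z - b), neg_sub, neg_sub]
  nlinarith

end Jump

/-- The fluxes of a front configuration at a fixed time. The fronts `x i` move with the speeds
`xd i`, the states `w i` change at the rates `wd i`, and on the `i`-th plateau the flux at the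
position `ξ` is the affine function `A i - wd i * ξ`, as the balance law requires. -/
structure IsFluxProfile (F G : ℝ → ℝ) (n : ℕ) (x w xd wd A : ℕ → ℝ) : Prop where
  rate_first : wd 0 = 0
  rate_last : wd n = 0
  /-- At its right end, which is the left side of a front, the flux of a plateau is the one
  selected by the jump there. -/
  flux_left : ∀ i < n, A i - wd i * x i = jumpFlux F G (w i) (w (i + 1)) (w i)
  /-- At its left end, which is the right side of a front, the flux of a plateau is the one
  selected by the jump there. -/
  flux_right : ∀ i < n, A (i + 1) - wd (i + 1) * x i = jumpFlux F G (w i) (w (i + 1)) (w (i + 1))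
  /-- On a closed plateau the flux lies between the two fluxes of the state. -/
  flux_mem : ∀ i ≤ n, ∀ ξ, (∀ j < i, x j ≤ ξ) → (∀ j, i ≤ j → j < n → ξ ≤ x j) →
    F (w i) ≤ A i - wd i * ξ ∧ A i - wd i * ξ ≤ G (w i)
  jump_ne : ∀ i < n, w i ≠ w (i + 1)
  liu : ∀ i < n, LiuAdmissible (jumpFlux F G (w i) (w (i + 1))) (w i) (w (i + 1))
  speed : ∀ i < n, xd i = rhSpeed (jumpFlux F G (w i) (w (i + 1))) (w i) (w (i + 1))

/-! ### Merging the fronts of two configurations -/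

/-- The positions of the fronts of two configurations in the order prescribed by `A`: the `k`-th
front is the next one of the first configuration if `k ∈ A`, and the next one of the second
configuration otherwise. -/
noncomputable def mergedFront (A : Finset ℕ) (x y : ℕ → ℝ) (k : ℕ) : ℝ :=
  if k ∈ A then x (Nat.count (· ∈ A) k) else y (Nat.count (· ∉ A) k)

/-- `A` describes a shuffle of `n` fronts `x` with `m` fronts `y` that is sorted by position. -/
structure IsSortedShuffle (A : Finset ℕ) (n m : ℕ) (x y : ℕ → ℝ) : Prop where
  count_mem : Nat.count (· ∈ A) (n + m) = n
  count_notMem : Nat.count (· ∉ A) (n + m) = m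
  sorted : ∀ k l, k ≤ l → l < n + m → mergedFront A x y k ≤ mergedFront A x y l

/-- `Nat.count p` attains on `{l | p l}` every value below its value at `k`. -/
lemma exists_of_lt_count (p : ℕ → Prop) [DecidablePred p] {i k : ℕ} (h : i < Nat.count p k) :
    ∃ l < k, p l ∧ Nat.count p l = i := by
  induction k with
  | zero => simp at h
  | succ k ih =>
    rw [Nat.count_succ] at h
    by_cases hk : p k
    · rw [if_pos hk] at h
      rcases (Nat.lt_succ_iff.1 h).eq_or_lt with rfl | h
      · exact ⟨k, by omega, hk, rfl⟩
      · obtain ⟨l, hl, h⟩ := ih h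
        exact ⟨l, by omega, h⟩
    · rw [if_neg hk] at h
      obtain ⟨l, hl, h⟩ := ih h
      exact ⟨l, by omega, h⟩

lemma count_lt_of_lt {p : ℕ → Prop} [DecidablePred p] {k N : ℕ} (h : p k) (hk : k < N) :
    Nat.count p k < Nat.count p N :=
  Nat.count_strict_mono h hk

section Shuffle

variable {A : Finset ℕ} {n m k : ℕ} {x y : ℕ → ℝ}

lemma mergedFront_of_mem (h : k ∈ A) : mergedFront A x y k = x (Nat.count (· ∈ A) k) := if_pos h

lemma mergedFront_of_notMem (h : k ∉ A) : mergedFront A x y k = y (Nat.count (· ∉ A) k) := if_neg h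

lemma exists_lt_mergedFront_eq_first {i : ℕ} (hi : i < Nat.count (· ∈ A) k) :
    ∃ l < k, mergedFront A x y l = x i := by
  obtain ⟨l, hl, hA, rfl⟩ := exists_of_lt_count _ hi
  exact ⟨l, hl, mergedFront_of_mem hA⟩

lemma exists_lt_mergedFront_eq_second {i : ℕ} (hi : i < Nat.count (· ∉ A) k) :
    ∃ l < k, mergedFront A x y l = y i := by
  obtain ⟨l, hl, hA, rfl⟩ := exists_of_lt_count _ hi
  exact ⟨l, hl, mergedFront_of_notMem hA⟩

namespace IsSortedShuffle

lemma first_lt (h : IsSortedShuffle A n m x y) (hk : k < n + m) (hA : k ∈ A) :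
    Nat.count (· ∈ A) k < n := by
  have := count_lt_of_lt (p := (· ∈ A)) hA hk
  rwa [h.count_mem] at this

lemma second_lt (h : IsSortedShuffle A n m x y) (hk : k < n + m) (hA : k ∉ A) :
    Nat.count (· ∉ A) k < m := by
  have := count_lt_of_lt (p := (· ∉ A)) hA hk
  rwa [h.count_notMem] at this

lemma first_le (h : IsSortedShuffle A n m x y) (hk : k ≤ n + m) : Nat.count (· ∈ A) k ≤ n :=
  (Nat.count_monotone _ hk).trans_eq h.count_mem

lemma second_le (h : IsSortedShuffle A n m x y) (hk : k ≤ n + m) : Nat.count (· ∉ A) k ≤ m :=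
  (Nat.count_monotone _ hk).trans_eq h.count_notMem

lemma first_after (h : IsSortedShuffle A n m x y) {i : ℕ} (hi : Nat.count (· ∈ A) k ≤ i)
    (hin : i < n) : ∃ l, k ≤ l ∧ l < n + m ∧ mergedFront A x y l = x i := by
  obtain ⟨l, hl, hA, rfl⟩ := exists_of_lt_count (· ∈ A) (hin.trans_eq h.count_mem.symm)
  refine ⟨l, ?_, hl, mergedFront_of_mem hA⟩
  by_contra! hlt
  exact (count_lt_of_lt (p := (· ∈ A)) hA hlt).not_ge hi

lemma second_after (h : IsSortedShuffle A n m x y) {i : ℕ} (hi : Nat.count (· ∉ A) k ≤ i)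
    (hin : i < m) : ∃ l, k ≤ l ∧ l < n + m ∧ mergedFront A x y l = y i := by
  obtain ⟨l, hl, hA, rfl⟩ := exists_of_lt_count (· ∉ A) (hin.trans_eq h.count_notMem.symm)
  refine ⟨l, ?_, hl, mergedFront_of_notMem hA⟩
  by_contra! hlt
  exact (count_lt_of_lt (p := (· ∉ A)) hA hlt).not_ge hi

end IsSortedShuffle

lemma mergedFront_le {c : ℝ} (hA : Nat.count (· ∈ A) (n + m) = n)
    (hB : Nat.count (· ∉ A) (n + m) = m) (hx : ∀ i < n, x i ≤ c)
    (hy : ∀ j < m, y j ≤ c) (hk : k < n + m) : mergedFront A x y k ≤ c := by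
  by_cases h : k ∈ A
  · rw [mergedFront_of_mem h]
    exact hx _ ((count_lt_of_lt (p := (· ∈ A)) h hk).trans_eq hA)
  · rw [mergedFront_of_notMem h]
    exact hy _ ((count_lt_of_lt (p := (· ∉ A)) h hk).trans_eq hB)

lemma count_congr_of_lt {p q : ℕ → Prop} [DecidablePred p] [DecidablePred q] {N : ℕ}
    (h : ∀ k < N, p k ↔ q k) {k : ℕ} (hk : k ≤ N) : Nat.count p k = Nat.count q k := by
  induction k with
  | zero => simp
  | succ k ih =>
    rw [Nat.count_succ, Nat.count_succ, ih (by omega)]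
    simp [h k (by omega)]

lemma mergedFront_congr {B : Finset ℕ} {N : ℕ} (h : ∀ k < N, k ∈ A ↔ k ∈ B) (hk : k < N) :
    mergedFront A x y k = mergedFront B x y k := by
  have h1 := count_congr_of_lt (p := (· ∈ A)) (q := (· ∈ B)) h hk.le
  have h2 := count_congr_of_lt (p := (· ∉ A)) (q := (· ∉ B)) (fun l hl => not_congr (h l hl)) hk.le
  by_cases hA : k ∈ A
  · rw [mergedFront_of_mem hA, mergedFront_of_mem ((h k hk).1 hA), h1]
  · rw [mergedFront_of_notMem hA, mergedFront_of_notMem (fun hB => hA ((h k hk).2 hB)), h2]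

/-- Two sorted lists of fronts can be merged; by induction, remove the rightmost front. -/
theorem exists_isSortedShuffle (n m : ℕ) (x y : ℕ → ℝ)
    (hx : ∀ i j, i ≤ j → j < n → x i ≤ x j) (hy : ∀ i j, i ≤ j → j < m → y i ≤ y j) :
    ∃ A ⊆ Finset.range (n + m), IsSortedShuffle A n m x y := by
  induction hN : n + m generalizing n m with
  | zero =>
    obtain ⟨rfl, rfl⟩ : n = 0 ∧ m = 0 := by omega
    exact ⟨∅, by simp, ⟨by simp, by simp, by simp⟩⟩
  | succ N ih =>
    by_cases hlast : 0 < n ∧ (m = 0 ∨ y (m - 1) ≤ x (n - 1))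
    · obtain ⟨n, rfl⟩ : ∃ n', n = n' + 1 := ⟨n - 1, by omega⟩
      obtain ⟨A, hAN, hA⟩ := ih n m (fun i j h1 h2 => hx i j h1 (by omega)) hy (by omega)
      have hNm : N = n + m := by omega
      subst hNm
      have hmem : ∀ k < n + m, k ∈ insert (n + m) A ↔ k ∈ A := fun k hk => by
        simp [hk.ne]
      have c1 := count_congr_of_lt (p := (· ∈ insert (n + m) A)) (q := (· ∈ A)) hmem le_rfl
      have c2 := count_congr_of_lt (p := (· ∉ insert (n + m) A)) (q := (· ∉ A))
        (fun l hl => not_congr (hmem l hl)) le_rfl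
      rw [hA.count_mem] at c1
      rw [hA.count_notMem] at c2
      refine ⟨insert (n + m) A, ?_, ?_, ?_, ?_⟩
      · intro k hk
        rcases Finset.mem_insert.1 hk with rfl | hk
        · simp
        · have := Finset.mem_range.1 (hAN hk)
          exact Finset.mem_range.2 (by omega)
      · rw [show n + 1 + m = n + m + 1 by omega, Nat.count_succ, c1]; simp
      · rw [show n + 1 + m = n + m + 1 by omega, Nat.count_succ, c2]; simp
      · intro k l hkl hl
        rcases (show l ≤ n + m by omega).eq_or_lt with rfl | hl'
        · rw [mergedFront_of_mem (k := n + m) (by simp), c1]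
          rcases hkl.eq_or_lt with rfl | hkl
          · rw [mergedFront_of_mem (by simp), c1]
          · rw [mergedFront_congr hmem hkl]
            refine mergedFront_le hA.count_mem hA.count_notMem (fun i hi => hx _ _ hi.le (by omega))
              (fun j hj => ?_) hkl
            rcases hlast.2 with h | h
            · omega
            · exact (hy _ _ (by omega) (by omega)).trans h
        · rw [mergedFront_congr hmem hl', mergedFront_congr hmem (hkl.trans_lt hl')]
          exact hA.sorted k l hkl hl'
    · have hm : 0 < m := by
        by_contra hm
        exact hlast ⟨by omega, Or.inl (by omega)⟩
      obtain ⟨m, rfl⟩ : ∃ m', m = m' + 1 := ⟨m - 1, by omega⟩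
      have hxy : ∀ i < n, x i ≤ y m := by
        intro i hi
        by_contra! h
        exact hlast ⟨by omega, Or.inr (h.le.trans (hx _ _ (by omega) (by omega)))⟩
      obtain ⟨A, hAN, hA⟩ := ih n m hx (fun i j h1 h2 => hy i j h1 (by omega)) (by omega)
      have hNm : N = n + m := by omega
      subst hNm
      have hn : n + m ∉ A := fun h => by simpa using hAN h
      refine ⟨A, hAN.trans (Finset.range_mono (by omega)), ?_, ?_, ?_⟩
      · rw [← add_assoc, Nat.count_succ, hA.count_mem]; simp [hn]
      · rw [← add_assoc, Nat.count_succ, hA.count_notMem]; simp [hn]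
      · intro k l hkl hl
        rcases (show l ≤ n + m by omega).eq_or_lt with rfl | hl'
        · rw [mergedFront_of_notMem (k := n + m) hn, hA.count_notMem]
          rcases hkl.eq_or_lt with rfl | hkl
          · rw [mergedFront_of_notMem hn, hA.count_notMem]
          · exact mergedFront_le hA.count_mem hA.count_notMem hxy
              (fun j hj => hy _ _ (by omega) (by omega)) hkl
        · exact hA.sorted k l hkl hl'

end Shuffle

section Shuffle

variable {S : Finset ℕ} {n m : ℕ} {x y w z : ℕ → ℝ}

/-- The positive part of the difference of the two states between the merged fronts `k - 1` and
`k`. -/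
noncomputable def mergedExcess (S : Finset ℕ) (w z : ℕ → ℝ) (k : ℕ) : ℝ :=
  max (w (Nat.count (· ∈ S) k) - z (Nat.count (· ∉ S) k)) 0

/-- The integral of the positive part of the difference of two step functions, written as a sum
over the merged fronts after a summation by parts. -/
noncomputable def shuffleSum (S : Finset ℕ) (n m : ℕ) (x y w z : ℕ → ℝ) : ℝ :=
  ∑ k ∈ Finset.range (n + m),
    mergedFront S x y k * (mergedExcess S w z k - mergedExcess S w z (k + 1))

/-- The formal time derivative of `shuffleSum` is nonpositive: the contribution of each merged
front is bounded by a difference of `c * (flux of w - flux of z)`, and these differences telescope.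
The factors `c k` are the values of the Heaviside graph that differentiate the positive parts. -/
theorem shuffleSum_rate_nonpos {F G : ℝ → ℝ} {xd wd A yd zd B : ℕ → ℝ}
    (hu : IsFluxProfile F G n x w xd wd A) (hv : IsFluxProfile F G m y z yd zd B)
    (hS : IsSortedShuffle S n m x y) (c : ℕ → ℝ)
    (hc : ∀ k ≤ n + m, IsHeaviside (c k) (w (Nat.count (· ∈ S) k) - z (Nat.count (· ∉ S) k)))
    (hc0 : c 0 = 0) (hcN : c (n + m) = 0) :
    ∑ k ∈ Finset.range (n + m),
      (mergedFront S xd yd k * (mergedExcess S w z k - mergedExcess S w z (k + 1)) +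
        mergedFront S x y k *
          (c k * (wd (Nat.count (· ∈ S) k) - zd (Nat.count (· ∉ S) k)) -
            c (k + 1) * (wd (Nat.count (· ∈ S) (k + 1)) - zd (Nat.count (· ∉ S) (k + 1))))) ≤
      0 := by
  have htel := Finset.sum_range_sub'
    (fun k => c k * (A (Nat.count (· ∈ S) k) - B (Nat.count (· ∉ S) k))) (n + m)
  rw [hc0, hcN, zero_mul, zero_mul, sub_zero] at htel
  rw [← htel]
  refine Finset.sum_le_sum fun k hk => ?_
  have hk := Finset.mem_range.1 hk
  have hck := hc k hk.le
  have hck' := hc (k + 1) hk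
  have hi := hS.first_le hk.le
  have hj := hS.second_le hk.le
  unfold mergedExcess
  by_cases hkS : k ∈ S
  · have e1 : Nat.count (· ∈ S) (k + 1) = Nat.count (· ∈ S) k + 1 := by
      rw [Nat.count_succ, if_pos hkS]
    have e2 : Nat.count (· ∉ S) (k + 1) = Nat.count (· ∉ S) k := by
      rw [Nat.count_succ, if_neg (not_not.2 hkS), add_zero]
    have hin := hS.first_lt hk hkS
    rw [e1, e2] at hck'
    rw [e1, e2, mergedFront_of_mem hkS, mergedFront_of_mem hkS]
    have hmem := hv.flux_mem _ hj (x (Nat.count (· ∈ S) k))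
      (fun j hj => by
        obtain ⟨l, hl, hl'⟩ := exists_lt_mergedFront_eq_second (x := x) (y := y) hj
        rw [← hl', ← mergedFront_of_mem (x := x) (y := y) hkS]
        exact hS.sorted l k hl.le hk)
      (fun j hj hjm => by
        obtain ⟨l, hl, hlN, hl'⟩ := hS.second_after hj hjm
        rw [← hl', ← mergedFront_of_mem (x := x) (y := y) hkS]
        exact hS.sorted k l hl hlN)
    have key := jump_first_le (hu.jump_ne _ hin) (hu.liu _ hin) hmem.1 hmem.2 hck hck'
    rw [← hu.speed _ hin, ← hu.flux_left _ hin, ← hu.flux_right _ hin] at key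
    linarith
  · have e1 : Nat.count (· ∈ S) (k + 1) = Nat.count (· ∈ S) k := by
      rw [Nat.count_succ, if_neg hkS, add_zero]
    have e2 : Nat.count (· ∉ S) (k + 1) = Nat.count (· ∉ S) k + 1 := by
      rw [Nat.count_succ, if_pos hkS]
    have hjm := hS.second_lt hk hkS
    rw [e1, e2] at hck'
    rw [e1, e2, mergedFront_of_notMem hkS, mergedFront_of_notMem hkS]
    have hmem := hu.flux_mem _ hi (y (Nat.count (· ∉ S) k))
      (fun j hj => by
        obtain ⟨l, hl, hl'⟩ := exists_lt_mergedFront_eq_first (x := x) (y := y) hj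
        rw [← hl', ← mergedFront_of_notMem (x := x) (y := y) hkS]
        exact hS.sorted l k hl.le hk)
      (fun j hj hjm => by
        obtain ⟨l, hl, hlN, hl'⟩ := hS.first_after hj hjm
        rw [← hl', ← mergedFront_of_notMem (x := x) (y := y) hkS]
        exact hS.sorted k l hl hlN)
    have key := jump_second_le (hv.jump_ne _ hjm) (hv.liu _ hjm) hmem.1 hmem.2 hck hck'
    rw [← hv.speed _ hjm, ← hv.flux_left _ hjm, ← hv.flux_right _ hjm] at key
    linarith

end Shuffle

/-! ### Step functions -/

section StepFunction

variable {n m : ℕ} {x y w z : ℕ → ℝ} {ξ : ℝ}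

lemma stepFunction_eq {k : ℕ} (hk : k ≤ n) (h1 : ∀ l < k, x l ≤ ξ)
    (h2 : ∀ l, k ≤ l → l < n → ξ < x l) : stepFunction n x w ξ = w k := by
  have : (Finset.range n).filter (fun i => x i ≤ ξ) = Finset.range k := by
    ext l
    simp only [Finset.mem_filter, Finset.mem_range]
    refine ⟨fun ⟨hl, hl'⟩ => ?_, fun hl => ⟨by omega, h1 l hl⟩⟩
    by_contra! hkl
    exact (h2 l hkl hl).not_ge hl'
  rw [stepFunction, this, Finset.card_range]

lemma exists_plateau (hx : ∀ i j, i ≤ j → j < n → x i ≤ x j) (ξ : ℝ) :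
    ∃ k ≤ n, (∀ l < k, x l ≤ ξ) ∧ ∀ l, k ≤ l → l < n → ξ < x l := by
  classical
  have hex : ∃ k, n ≤ k ∨ ξ < x k := ⟨n, Or.inl le_rfl⟩
  refine ⟨Nat.find hex, Nat.find_min' hex (Or.inl le_rfl), fun l hl => ?_, fun l hl hln => ?_⟩
  · have := Nat.find_min hex hl
    push Not at this
    exact this.2
  · rcases Nat.find_spec hex with h | h
    · omega
    · exact h.trans_le (hx _ _ hl hln)

lemma integral_stepFunction (hx : ∀ i j, i ≤ j → j < n → x i ≤ x j) (h0 : w 0 = 0)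
    (hn : w n = 0) :
    Integrable (stepFunction n x w) ∧
      ∫ ξ, stepFunction n x w ξ = ∑ k ∈ Finset.range n, x k * (w k - w (k + 1)) := by
  -- A jump at `x k` is counted on `[x 0, x k)`, with the opposite sign: the jumps add up to `0`.
  have heq : stepFunction n x w = fun ξ => ∑ k ∈ Finset.range n,
      (Ico (x 0) (x k)).indicator (fun _ => w k - w (k + 1)) ξ := by
    funext ξ
    obtain ⟨K, hK, h1, h2⟩ := exists_plateau hx ξ
    rw [stepFunction_eq hK h1 h2]
    rcases Nat.eq_zero_or_pos K with rfl | hpos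
    · rw [h0]
      refine (Finset.sum_eq_zero fun k hk =>
        indicator_of_notMem (fun (hξ : ξ ∈ Ico (x 0) (x k)) => ?_) _).symm
      have hk := Finset.mem_range.1 hk
      exact (h2 0 le_rfl (by omega)).not_ge hξ.1
    · have hsplit := Finset.sum_range_add_sum_Ico (fun k =>
        (Ico (x 0) (x k)).indicator (fun _ => w k - w (k + 1)) ξ) hK
      rw [← hsplit, Finset.sum_eq_zero, zero_add]
      · rw [Finset.sum_congr rfl (g := fun k => w k - w (k + 1))]
        · rw [Finset.sum_Ico_eq_sub _ hK, Finset.sum_range_sub', Finset.sum_range_sub', hn]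
          ring
        · intro k hk
          have hk := Finset.mem_Ico.1 hk
          exact indicator_of_mem (show ξ ∈ Ico (x 0) (x k) from ⟨h1 0 hpos, h2 k hk.1 hk.2⟩) _
      · intro k hk
        exact indicator_of_notMem (fun hξ => (h1 k (Finset.mem_range.1 hk)).not_gt hξ.2) _
  have hint : ∀ k ∈ Finset.range n, Integrable
      ((Ico (x 0) (x k)).indicator (fun _ : ℝ => w k - w (k + 1))) := fun k _ =>
    (integrable_indicator_iff measurableSet_Ico).2
      (integrableOn_const (by simp))
  rw [heq]
  refine ⟨integrable_finsetSum _ hint, ?_⟩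
  rw [integral_finsetSum _ hint]
  have hterm : ∀ k ∈ Finset.range n,
      ∫ ξ, (Ico (x 0) (x k)).indicator (fun _ => w k - w (k + 1)) ξ =
        x k * (w k - w (k + 1)) - x 0 * (w k - w (k + 1)) := fun k hk => by
    rw [integral_indicator measurableSet_Ico, setIntegral_const,
      Real.volume_real_Ico_of_le (hx 0 k (Nat.zero_le _) (Finset.mem_range.1 hk)), smul_eq_mul,
      sub_mul]
  rw [Finset.sum_congr rfl hterm, Finset.sum_sub_distrib, ← Finset.mul_sum, Finset.sum_range_sub',
    h0, hn]
  ring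

/-- The first step function, with the fronts of the second one added as jumps of size zero. -/
lemma IsSortedShuffle.stepFunction_first {S : Finset ℕ} (h : IsSortedShuffle S n m x y) (ξ : ℝ) :
    stepFunction n x w ξ =
      stepFunction (n + m) (mergedFront S x y) (fun k => w (Nat.count (· ∈ S) k)) ξ := by
  obtain ⟨K, hK, h1, h2⟩ := exists_plateau h.sorted ξ
  rw [stepFunction_eq hK h1 h2]
  refine stepFunction_eq (h.first_le hK) (fun l hl => ?_) (fun l hl hln => ?_)
  · obtain ⟨k, hk, hk'⟩ := exists_lt_mergedFront_eq_first (x := x) (y := y) hl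
    exact hk' ▸ h1 k hk
  · obtain ⟨k, hk, hkN, hk'⟩ := h.first_after hl hln
    exact hk' ▸ h2 k hk hkN

lemma IsSortedShuffle.stepFunction_second {S : Finset ℕ} (h : IsSortedShuffle S n m x y) (ξ : ℝ) :
    stepFunction m y z ξ =
      stepFunction (n + m) (mergedFront S x y) (fun k => z (Nat.count (· ∉ S) k)) ξ := by
  obtain ⟨K, hK, h1, h2⟩ := exists_plateau h.sorted ξ
  rw [stepFunction_eq hK h1 h2]
  refine stepFunction_eq (h.second_le hK) (fun l hl => ?_) (fun l hl hln => ?_)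
  · obtain ⟨k, hk, hk'⟩ := exists_lt_mergedFront_eq_second (x := x) (y := y) hl
    exact hk' ▸ h1 k hk
  · obtain ⟨k, hk, hkN, hk'⟩ := h.second_after hl hln
    exact hk' ▸ h2 k hk hkN

theorem IsSortedShuffle.integral_excess {S : Finset ℕ} (h : IsSortedShuffle S n m x y)
    (h0 : w 0 ≤ z 0) (hN : w n ≤ z m) :
    Integrable (fun ξ => max (stepFunction n x w ξ - stepFunction m y z ξ) 0) ∧
      ∫ ξ, max (stepFunction n x w ξ - stepFunction m y z ξ) 0 = shuffleSum S n m x y w z := by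
  have heq : (fun ξ => max (stepFunction n x w ξ - stepFunction m y z ξ) 0) =
      stepFunction (n + m) (mergedFront S x y) (mergedExcess S w z) := by
    funext ξ
    rw [h.stepFunction_first (w := w), h.stepFunction_second (z := z)]
    rfl
  rw [heq]
  refine integral_stepFunction h.sorted ?_ ?_
  · simp [mergedExcess, h0]
  · simp [mergedExcess, h.count_mem, h.count_notMem, hN]

end StepFunction

/-! ### Front configurations evolving in time -/

/-- A front configuration on `[a, b]` that satisfies the balance law in the open interval. In
contrast to `IsFrontRun`, the states near `±∞` are arbitrary constants, so that constant functions
are included. -/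
structure IsFrontFamily (F G : ℝ → ℝ) (a b : ℝ) (n : ℕ) (x w : ℕ → ℝ → ℝ) : Prop where
  cont_front : ∀ i < n, ContinuousOn (x i) (Icc a b)
  cont_state : ∀ i ≤ n, ContinuousOn (w i) (Icc a b)
  front_le : ∀ t ∈ Icc a b, ∀ i j, i ≤ j → j < n → x i t ≤ x j t
  profile : ∀ t ∈ Ioo a b, ∃ xd wd A : ℕ → ℝ,
    (∀ i < n, HasDerivAt (x i) (xd i) t) ∧ (∀ i ≤ n, HasDerivAt (w i) (wd i) t) ∧
      IsFluxProfile F G n (fun i => x i t) (fun i => w i t) xd wd A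

section Families

variable {F G : ℝ → ℝ} {a b a' b' : ℝ} {n m : ℕ} {x w y z : ℕ → ℝ → ℝ}

lemma IsFrontFamily.restrict (h : IsFrontFamily F G a b n x w) (ha : a ≤ a') (hb : b' ≤ b) :
    IsFrontFamily F G a' b' n x w where
  cont_front i hi := (h.cont_front i hi).mono (Icc_subset_Icc ha hb)
  cont_state i hi := (h.cont_state i hi).mono (Icc_subset_Icc ha hb)
  front_le t ht := h.front_le t (Icc_subset_Icc ha hb ht)
  profile t ht := h.profile t (Ioo_subset_Ioo ha hb ht)

lemma isFrontFamily_const (hFG : ∀ s, F s ≤ G s) (a b M : ℝ) :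
    IsFrontFamily F G a b 0 (fun _ _ => 0) (fun _ _ => M) where
  cont_front i hi := by omega
  cont_state i _ := continuousOn_const
  front_le t _ i j _ hj := by omega
  profile t _ := ⟨fun _ => 0, fun _ => 0, fun _ => F M, by simp,
    fun i _ => hasDerivAt_const t M, ⟨rfl, rfl, by simp, by simp,
      fun i _ ξ _ _ => by simp [hFG], by simp, by simp, by simp⟩⟩

/-- The balance law on a plateau: the three cases of `plateauRate` all express the inflow at the
left end minus the outflow at the right end. -/
lemma plateauRate_mul {l p r len : ℝ} (hl : l ≠ p) (hr : p ≠ r) (hlen : len ≠ 0) :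
    plateauRate F G l p r len * len = jumpFlux F G l p p - jumpFlux F G p r p := by
  unfold plateauRate
  rcases lt_or_gt_of_ne hl with h1 | h1 <;> rcases lt_or_gt_of_ne hr with h2 | h2
  · rw [if_neg (by simp [h2.le]), if_neg (by simp [h1.le]), jumpFlux_of_lt h1, jumpFlux_of_lt h2]
    ring
  · rw [if_pos (max_lt h1 h2), div_mul_cancel₀ _ hlen, jumpFlux_of_lt h1, jumpFlux_of_gt h2]
  · rw [if_neg (by simp [h2.le]), if_pos (lt_min h1 h2), div_mul_cancel₀ _ hlen, jumpFlux_of_gt h1,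
      jumpFlux_of_lt h2]
  · rw [if_neg (by simp [h1.le]), if_neg (by simp [h2.le]), jumpFlux_of_gt h1, jumpFlux_of_gt h2]
    ring

lemma IsFrontRun.front_le (h : IsFrontRun F G a b n x w) (hab : a < b) {t : ℝ}
    (ht : t ∈ Icc a b) (i j : ℕ) (hij : i ≤ j) (hj : j < n) : x i t ≤ x j t := by
  induction j, hij using Nat.le_induction with
  | base => exact le_rfl
  | succ j hij ih =>
    refine (ih (by omega)).trans ?_
    have hcl : t ∈ closure (Ioo a b) := by rwa [closure_Ioo hab.ne]
    exact ContinuousWithinAt.closure_le hcl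
      ((h.cont_front j (by omega) t ht).mono Ioo_subset_Icc_self)
      ((h.cont_front (j + 1) hj t ht).mono Ioo_subset_Icc_self)
      (fun s hs => (h.front_lt j hj s hs).le)

/-- The rates of change of the states in a run. -/
lemma IsFrontRun.hasDerivAt_state (h : IsFrontRun F G a b n x w) {t : ℝ} (ht : t ∈ Ioo a b) :
    ∃ wd : ℕ → ℝ, wd 0 = 0 ∧ wd n = 0 ∧ (∀ i ≤ n, HasDerivAt (w i) (wd i) t) ∧
      ∀ i, i + 1 < n → wd (i + 1) =
        plateauRate F G (w i t) (w (i + 1) t) (w (i + 2) t) (x (i + 1) t - x i t) := by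
  have hnhds : Icc a b ∈ 𝓝 t := Icc_mem_nhds ht.1 ht.2
  have hzero : ∀ {e : ℝ → ℝ}, (∀ s ∈ Icc a b, e s = 0) → HasDerivAt e 0 t := fun he =>
    (hasDerivAt_const t (0 : ℝ)).congr_of_eventuallyEq
      (by filter_upwards [hnhds] with s hs using he s hs)
  refine ⟨fun i => if i = 0 ∨ i = n then 0 else plateauRate F G (w (i - 1) t) (w i t)
    (w (i + 1) t) (x i t - x (i - 1) t), by simp, by simp, fun i hi => ?_, fun i hi => ?_⟩
  · rcases Nat.eq_zero_or_pos i with rfl | hpos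
    · simpa using hzero h.left_zero
    rcases hi.eq_or_lt with rfl | hi
    · simpa using hzero h.right_zero
    · obtain ⟨i, rfl⟩ : ∃ i', i = i' + 1 := ⟨i - 1, by omega⟩
      simpa [hi.ne] using h.state_deriv i hi t ht
  · simp [hi.ne]

lemma IsFrontRun.isFrontFamily (hFG : ∀ s, F s ≤ G s) (h : IsFrontRun F G a b n x w)
    (hab : a < b) : IsFrontFamily F G a b n x w where
  cont_front := h.cont_front
  cont_state := h.cont_state
  front_le _ ht := h.front_le hab ht
  profile t ht := by
    obtain ⟨wd, hd0, hdn, hd, hrate⟩ := h.hasDerivAt_state ht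
    have htI : t ∈ Ico a b := Ioo_subset_Ico_self ht
    have hflux : ∀ i, i + 1 < n → wd (i + 1) * (x (i + 1) t - x i t) =
        jumpFlux F G (w i t) (w (i + 1) t) (w (i + 1) t) -
          jumpFlux F G (w (i + 1) t) (w (i + 2) t) (w (i + 1) t) := fun i hi => by
      rw [hrate i hi]
      exact plateauRate_mul (h.jump_ne i (by omega) t htI) (h.jump_ne (i + 1) hi t htI)
        (sub_pos.2 (h.front_lt i hi t ht)).ne'
    -- For `i = n = 0` the value `A 0` is only required to lie between `F 0` and `G 0`.
    set A : ℕ → ℝ := fun i => if i < n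
      then wd i * x i t + jumpFlux F G (w i t) (w (i + 1) t) (w i t)
      else jumpFlux F G (w (i - 1) t) (w i t) (w i t) with hA
    have hleft : ∀ i < n, A i - wd i * x i t = jumpFlux F G (w i t) (w (i + 1) t) (w i t) :=
      fun i hi => by simp only [hA, if_pos hi]; ring
    have hright : ∀ i < n, A (i + 1) - wd (i + 1) * x i t =
        jumpFlux F G (w i t) (w (i + 1) t) (w (i + 1) t) := fun i hi => by
      rcases (show i + 1 ≤ n by omega).eq_or_lt with rfl | hi'
      · simp [hA, hdn]
      · have := hflux i hi'
        have := hleft (i + 1) hi'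
        linarith
    refine ⟨_, wd, A, fun i hi => h.front_deriv i hi t ht, hd, hd0, hdn, hleft, hright, ?_,
      fun i hi => h.jump_ne i hi t htI, fun i hi => h.liu i hi t htI, fun _ _ => rfl⟩
    intro i hi ξ h1 h2
    have hconst : wd i = 0 → F (w i t) ≤ A i - wd i * ξ ∧ A i - wd i * ξ ≤ G (w i t) := by
      intro h0
      simp only [hA, h0, zero_mul, zero_add, sub_zero]
      split_ifs
      exacts [⟨le_jumpFlux_apply hFG _, jumpFlux_apply_le hFG _⟩,
        ⟨le_jumpFlux_apply hFG _, jumpFlux_apply_le hFG _⟩]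
    rcases Nat.eq_zero_or_pos i with rfl | hpos
    · exact hconst hd0
    rcases hi.eq_or_lt with rfl | hi
    · exact hconst hdn
    obtain ⟨i, rfl⟩ : ∃ i', i = i' + 1 := ⟨i - 1, by omega⟩
    have h1 := h1 i (by omega)
    have h2 := h2 (i + 1) le_rfl hi
    have e1 := hleft (i + 1) hi
    have e2 := hright i (by omega)
    have b1 := le_jumpFlux_apply (a := w (i + 1) t) (b := w (i + 1 + 1) t) hFG (w (i + 1) t)
    have b2 := jumpFlux_apply_le (a := w (i + 1) t) (b := w (i + 1 + 1) t) hFG (w (i + 1) t)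
    have b3 := le_jumpFlux_apply (a := w i t) (b := w (i + 1) t) hFG (w (i + 1) t)
    have b4 := jumpFlux_apply_le (a := w i t) (b := w (i + 1) t) hFG (w (i + 1) t)
    rcases le_total 0 (wd (i + 1)) with hs | hs
    · have c1 := mul_le_mul_of_nonneg_left h1 hs
      have c2 := mul_le_mul_of_nonneg_left h2 hs
      constructor <;> linarith
    · have c1 := mul_le_mul_of_nonpos_left h1 hs
      have c2 := mul_le_mul_of_nonpos_left h2 hs
      constructor <;> linarith

end Families

/-! ### Monotonicity from one-sided derivatives -/

/-- The positive part of a function with a right derivative has a right derivative. -/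
lemma exists_hasDerivWithinAt_max_zero {e : ℝ → ℝ} {d t : ℝ} (he : HasDerivWithinAt e d (Ioi t) t) :
    ∃ c, IsHeaviside c (e t) ∧ (e t ≤ 0 → d = 0 → c = 0) ∧
      HasDerivWithinAt (fun s => max (e s) 0) (c * d) (Ioi t) t := by
  have hcont : Tendsto e (𝓝[>] t) (𝓝 (e t)) := he.continuousWithinAt
  rcases lt_trichotomy (e t) 0 with h | h | h
  · refine ⟨0, Or.inr (Or.inl ⟨h, rfl⟩), fun _ _ => rfl, ?_⟩
    rw [zero_mul]
    refine (hasDerivWithinAt_const t (Ioi t) (0 : ℝ)).congr_of_eventuallyEq ?_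
      (max_eq_right h.le)
    filter_upwards [hcont.eventually_lt_const h] with s hs using max_eq_right hs.le
  · have hmax : HasDerivWithinAt (fun s => max (e s) 0) (max d 0) (Ioi t) t := by
      rw [hasDerivWithinAt_iff_tendsto_slope' self_notMem_Ioi] at he ⊢
      refine (he.max (tendsto_const_nhds (x := (0 : ℝ)))).congr' ?_
      filter_upwards [self_mem_nhdsWithin] with s hs
      have hs : 0 < s - t := sub_pos.2 hs
      rw [slope_def_field, slope_def_field, h, max_self, sub_zero, sub_zero]
      rw [← max_div_div_right hs.le, zero_div]
    by_cases hd : 0 < d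
    · refine ⟨1, Or.inr (Or.inr ⟨h, Or.inr rfl⟩), fun _ h0 => absurd h0 hd.ne', ?_⟩
      rwa [max_eq_left hd.le, ← one_mul d] at hmax
    · refine ⟨0, Or.inr (Or.inr ⟨h, Or.inl rfl⟩), fun _ _ => rfl, ?_⟩
      rw [max_eq_right (not_lt.1 hd)] at hmax
      rwa [zero_mul]
  · refine ⟨1, Or.inl ⟨h, rfl⟩, fun h0 => absurd h h0.not_gt, ?_⟩
    rw [one_mul]
    refine he.congr_of_eventuallyEq ?_ (max_eq_left h.le)
    filter_upwards [hcont.eventually_const_lt h] with s hs using max_eq_left hs.le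

lemma antitoneOn_of_eventually_sub_le {f : ℝ → ℝ} {a b : ℝ} (hc : ContinuousOn f (Icc a b))
    (h : ∀ t ∈ Ioo a b, ∀ ε > 0, ∀ᶠ s in 𝓝[>] t, f s - f t ≤ ε * (s - t)) :
    AntitoneOn f (Icc a b) := by
  have hint : ∀ s t, a < s → s ≤ t → t ≤ b → f t ≤ f s := by
    intro s t has hst htb
    refine image_le_of_liminf_slope_right_le_deriv_boundary
      (hc.mono (Icc_subset_Icc has.le htb)) le_rfl (B := fun _ => f s) (B' := fun _ => 0)
      continuousOn_const (fun _ _ => hasDerivWithinAt_const _ _ _) ?_ (right_mem_Icc.2 hst)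
    intro r hr ε hε
    refine Eventually.frequently ?_
    filter_upwards [h r ⟨has.trans_le hr.1, hr.2.trans_le htb⟩ (ε / 2) (by linarith),
      self_mem_nhdsWithin] with q hq hqr
    have hqr : 0 < q - r := sub_pos.2 hqr
    rw [slope_def_field, div_lt_iff₀ hqr]
    nlinarith
  intro s hs t ht hst
  rcases hs.1.eq_or_lt with rfl | has
  · rcases hst.eq_or_lt with rfl | hat
    · exact le_rfl
    have hlim : Tendsto f (𝓝[>] a) (𝓝 (f a)) :=
      ((hc a hs).mono_left (nhdsWithin_le_of_mem
        (mem_of_superset (Ioc_mem_nhdsGT (hat.trans_le ht.2)) Ioc_subset_Icc_self)))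
    refine ge_of_tendsto hlim ?_
    filter_upwards [Ioc_mem_nhdsGT hat] with r hr using hint r t hr.1 hr.2 ht.2
  · exact hint s t has hst ht.2

/-- A function that is antitone on each cell of a partition of `[0, ∞)` is antitone. -/
lemma antitoneOn_of_partition {β : Type*} [Preorder β] {τ : ℕ → ℝ} (hmono : StrictMono τ)
    (hlim : Tendsto τ atTop atTop) {I : Set ℝ} [hI : I.OrdConnected] (hI0 : I ⊆ Ici (τ 0))
    {D : ℝ → β} (h : ∀ k, AntitoneOn D (I ∩ Icc (τ k) (τ (k + 1)))) : AntitoneOn D I := by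
  have key : ∀ k, AntitoneOn D (I ∩ Iic (τ k)) := by
    intro k
    induction k with
    | zero =>
      intro s hs t ht hst
      have : s = t := le_antisymm hst (ht.2.trans (hI0 hs.1))
      rw [this]
    | succ k ih =>
      intro s hs t ht hst
      rcases le_total t (τ k) with h1 | h1
      · exact ih ⟨hs.1, hst.trans h1⟩ ⟨ht.1, h1⟩ hst
      rcases le_total s (τ k) with h2 | h2
      · have hk : τ k ∈ I := hI.out hs.1 ht.1 ⟨h2, h1⟩
        exact (h k ⟨hk, le_rfl, (hmono (Nat.lt_succ_self k)).le⟩ ⟨ht.1, h1, ht.2⟩ h1).trans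
          (ih ⟨hs.1, h2⟩ ⟨hk, mem_Iic.2 le_rfl⟩ h2)
      · exact h k ⟨hs.1, h2, hs.2⟩ ⟨ht.1, h1, ht.2⟩ hst
  intro s hs t ht hst
  obtain ⟨k, hk⟩ := (hlim.eventually_ge_atTop t).exists
  exact key k ⟨hs, hst.trans hk⟩ ⟨ht, hk⟩ hst

/-! ### The excess of one configuration over another -/

section Excess

variable {F G : ℝ → ℝ} {a b : ℝ} {n m : ℕ} {x w y z : ℕ → ℝ → ℝ}

lemma tendsto_mergedFront {S : Finset ℕ} {l : Filter ℝ} {t : ℝ}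
    (hcS : Nat.count (· ∈ S) (n + m) = n) (hcN : Nat.count (· ∉ S) (n + m) = m)
    (hx : ∀ i < n, Tendsto (x i) l (𝓝 (x i t))) (hy : ∀ i < m, Tendsto (y i) l (𝓝 (y i t)))
    {k : ℕ} (hk : k < n + m) :
    Tendsto (fun s => mergedFront S (fun i => x i s) (fun i => y i s) k) l
      (𝓝 (mergedFront S (fun i => x i t) (fun i => y i t) k)) := by
  by_cases h : k ∈ S
  · simp only [mergedFront_of_mem h]
    exact hx _ ((count_lt_of_lt (p := (· ∈ S)) h hk).trans_eq hcS)
  · simp only [mergedFront_of_notMem h]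
    exact hy _ ((count_lt_of_lt (p := (· ∉ S)) h hk).trans_eq hcN)

/-- A shuffle that is not sorted remains so for a short time. -/
lemma eventually_not_isSortedShuffle {S : Finset ℕ} {l : Filter ℝ} {t : ℝ}
    (hx : ∀ i < n, Tendsto (x i) l (𝓝 (x i t))) (hy : ∀ i < m, Tendsto (y i) l (𝓝 (y i t)))
    (h : ¬ IsSortedShuffle S n m (fun i => x i t) (fun i => y i t)) :
    ∀ᶠ s in l, ¬ IsSortedShuffle S n m (fun i => x i s) (fun i => y i s) := by
  by_cases hcS : Nat.count (· ∈ S) (n + m) = n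
  swap
  · exact Eventually.of_forall fun s hs => hcS hs.count_mem
  by_cases hcN : Nat.count (· ∉ S) (n + m) = m
  swap
  · exact Eventually.of_forall fun s hs => hcN hs.count_notMem
  have : ∃ k l, k ≤ l ∧ l < n + m ∧ mergedFront S (fun i => x i t) (fun i => y i t) l <
      mergedFront S (fun i => x i t) (fun i => y i t) k := by
    by_contra! hcon
    exact h ⟨hcS, hcN, hcon⟩
  obtain ⟨k, q, hkq, hq, hlt⟩ := this
  filter_upwards [(tendsto_mergedFront hcS hcN hx hy hq).eventually_lt
    (tendsto_mergedFront hcS hcN hx hy (hkq.trans_lt hq)) hlt] with s hs hS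
  exact (hS.sorted k q hkq hq).not_gt hs

/-- The integral of the positive part of the difference of two front configurations. -/
noncomputable def excess (n m : ℕ) (x w y z : ℕ → ℝ → ℝ) (t : ℝ) : ℝ :=
  ∫ ξ, max (stepFunction n (fun i => x i t) (fun i => w i t) ξ -
    stepFunction m (fun i => y i t) (fun i => z i t) ξ) 0

lemma IsFrontFamily.exists_shuffle (hu : IsFrontFamily F G a b n x w)
    (hv : IsFrontFamily F G a b m y z) {t : ℝ} (ht : t ∈ Icc a b) :
    ∃ S ∈ (Finset.range (n + m)).powerset,
      IsSortedShuffle S n m (fun i => x i t) (fun i => y i t) := by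
  obtain ⟨S, hS, hS'⟩ := exists_isSortedShuffle n m (fun i => x i t) (fun i => y i t)
    (hu.front_le t ht) (hv.front_le t ht)
  exact ⟨S, Finset.mem_powerset.2 hS, hS'⟩

/-- Since only finitely many shuffles occur, a property of the excess near `t` may be checked for
each shuffle that is sorted at the time `t`. -/
lemma eventually_excess (hu : IsFrontFamily F G a b n x w)
    (hv : IsFrontFamily F G a b m y z) (h0 : ∀ t ∈ Icc a b, w 0 t ≤ z 0 t)
    (hN : ∀ t ∈ Icc a b, w n t ≤ z m t) {t : ℝ} (ht : t ∈ Icc a b) {l : Filter ℝ}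
    (hl : l ≤ 𝓝[Icc a b] t) {P : ℝ → ℝ → Prop}
    (h : ∀ S, IsSortedShuffle S n m (fun i => x i t) (fun i => y i t) →
      ∀ᶠ s in l, P s (shuffleSum S n m (fun i => x i s) (fun i => y i s) (fun i => w i s)
        (fun i => z i s))) :
    ∀ᶠ s in l, P s (excess n m x w y z s) := by
  have hall : ∀ S ∈ (Finset.range (n + m)).powerset, ∀ᶠ s in l,
      IsSortedShuffle S n m (fun i => x i s) (fun i => y i s) →
        P s (shuffleSum S n m (fun i => x i s) (fun i => y i s) (fun i => w i s)
          (fun i => z i s)) := by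
    intro S _
    by_cases hS : IsSortedShuffle S n m (fun i => x i t) (fun i => y i t)
    · filter_upwards [h S hS] with s hs _ using hs
    · filter_upwards [eventually_not_isSortedShuffle
        (fun i hi => (hu.cont_front i hi t ht).mono_left hl)
        (fun i hi => (hv.cont_front i hi t ht).mono_left hl) hS] with s hs hs'
      exact absurd hs' hs
  filter_upwards [(eventually_all_finset _).2 hall, hl self_mem_nhdsWithin] with s hs hsI
  obtain ⟨S, hS, hS'⟩ := hu.exists_shuffle hv hsI
  rw [excess, (hS'.integral_excess (h0 s hsI) (hN s hsI)).2]
  exact hs S hS hS'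

lemma continuousOn_excess (hu : IsFrontFamily F G a b n x w)
    (hv : IsFrontFamily F G a b m y z) (h0 : ∀ t ∈ Icc a b, w 0 t ≤ z 0 t)
    (hN : ∀ t ∈ Icc a b, w n t ≤ z m t) : ContinuousOn (excess n m x w y z) (Icc a b) := by
  intro t ht
  refine Metric.tendsto_nhds.2 fun ε hε => ?_
  refine eventually_excess hu hv h0 hN ht le_rfl
    (P := fun _ D => dist D (excess n m x w y z t) < ε) fun S hS => ?_
  rw [excess, (hS.integral_excess (h0 t ht) (hN t ht)).2]
  refine Metric.tendsto_nhds.1 ?_ ε hε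
  refine tendsto_finsetSum _ fun k hk => ?_
  have hk := Finset.mem_range.1 hk
  have hex : ∀ k ≤ n + m, Tendsto
      (fun s => mergedExcess S (fun i => w i s) (fun i => z i s) k) (𝓝[Icc a b] t)
      (𝓝 (mergedExcess S (fun i => w i t) (fun i => z i t) k)) := fun k hk =>
    (Tendsto.sub (hu.cont_state _ (hS.first_le hk) t ht)
      (hv.cont_state _ (hS.second_le hk) t ht)).max tendsto_const_nhds
  exact (tendsto_mergedFront hS.count_mem hS.count_notMem (fun i hi => hu.cont_front i hi t ht)
    (fun i hi => hv.cont_front i hi t ht) hk).mul ((hex k hk.le).sub (hex (k + 1) hk))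

/-- The sum that represents the excess for a fixed shuffle has a nonpositive right derivative at
each time at which the shuffle is sorted. -/
lemma exists_hasDerivWithinAt_shuffleSum (hu : IsFrontFamily F G a b n x w)
    (hv : IsFrontFamily F G a b m y z) (h0 : ∀ t ∈ Icc a b, w 0 t ≤ z 0 t)
    (hN : ∀ t ∈ Icc a b, w n t ≤ z m t) {t : ℝ} (ht : t ∈ Ioo a b) {S : Finset ℕ}
    (hS : IsSortedShuffle S n m (fun i => x i t) (fun i => y i t)) :
    ∃ d ≤ 0, HasDerivWithinAt (fun s => shuffleSum S n m (fun i => x i s) (fun i => y i s)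
      (fun i => w i s) (fun i => z i s)) d (Ioi t) t := by
  obtain ⟨xd, wd, A, hx, hw, hpu⟩ := hu.profile t ht
  obtain ⟨yd, zd, B, hy, hz, hpv⟩ := hv.profile t ht
  have htI := Ioo_subset_Icc_self ht
  have hc : ∀ k, ∃ c, k ≤ n + m →
      IsHeaviside c (w (Nat.count (· ∈ S) k) t - z (Nat.count (· ∉ S) k) t) ∧
      (w (Nat.count (· ∈ S) k) t - z (Nat.count (· ∉ S) k) t ≤ 0 →
        wd (Nat.count (· ∈ S) k) - zd (Nat.count (· ∉ S) k) = 0 → c = 0) ∧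
      HasDerivWithinAt (fun s => mergedExcess S (fun i => w i s) (fun i => z i s) k)
        (c * (wd (Nat.count (· ∈ S) k) - zd (Nat.count (· ∉ S) k))) (Ioi t) t := by
    intro k
    by_cases hk : k ≤ n + m
    · obtain ⟨c, hc⟩ := exists_hasDerivWithinAt_max_zero
        (((hw _ (hS.first_le hk)).sub (hz _ (hS.second_le hk))).hasDerivWithinAt (s := Ioi t))
      exact ⟨c, fun _ => hc⟩
    · exact ⟨0, fun h => absurd h hk⟩
  choose c hc using hc
  have hp : ∀ k < n + m, HasDerivWithinAt
      (fun s => mergedFront S (fun i => x i s) (fun i => y i s) k) (mergedFront S xd yd k)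
      (Ioi t) t := by
    intro k hk
    by_cases h : k ∈ S
    · simp only [mergedFront_of_mem h]
      exact (hx _ (hS.first_lt hk h)).hasDerivWithinAt
    · simp only [mergedFront_of_notMem h]
      exact (hy _ (hS.second_lt hk h)).hasDerivWithinAt
  have hc0 : c 0 = 0 := by
    refine (hc 0 (Nat.zero_le _)).2.1 ?_ ?_
    · simpa using h0 t htI
    · simp [hpu.rate_first, hpv.rate_first]
  have hcN : c (n + m) = 0 := by
    refine (hc (n + m) le_rfl).2.1 ?_ ?_
    · simpa [hS.count_mem, hS.count_notMem] using hN t htI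
    · simp [hS.count_mem, hS.count_notMem, hpu.rate_last, hpv.rate_last]
  refine ⟨_, shuffleSum_rate_nonpos hpu hpv hS c (fun k hk => (hc k hk).1) hc0 hcN, ?_⟩
  unfold shuffleSum
  refine HasDerivWithinAt.fun_sum fun k hk => ?_
  have hk := Finset.mem_range.1 hk
  exact (hp k hk).mul ((hc k hk.le).2.2.sub (hc (k + 1) hk).2.2)

theorem antitoneOn_excess (hu : IsFrontFamily F G a b n x w)
    (hv : IsFrontFamily F G a b m y z) (h0 : ∀ t ∈ Icc a b, w 0 t ≤ z 0 t)
    (hN : ∀ t ∈ Icc a b, w n t ≤ z m t) : AntitoneOn (excess n m x w y z) (Icc a b) := by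
  refine antitoneOn_of_eventually_sub_le (continuousOn_excess hu hv h0 hN) fun t ht ε hε => ?_
  have htI := Ioo_subset_Icc_self ht
  refine eventually_excess hu hv h0 hN htI (P := fun s D => D - excess n m x w y z t ≤ ε * (s - t))
    (le_inf (nhdsWithin_le_nhds) (le_principal_iff.2 (mem_nhdsWithin_of_mem_nhds
      (Icc_mem_nhds ht.1 ht.2)))) fun S hS => ?_
  rw [excess, (hS.integral_excess (h0 t htI) (hN t htI)).2]
  obtain ⟨d, hd, hder⟩ := exists_hasDerivWithinAt_shuffleSum hu hv h0 hN ht hS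
  rw [hasDerivWithinAt_iff_tendsto_slope' self_notMem_Ioi] at hder
  filter_upwards [hder.eventually_lt_const (hd.trans_lt hε), self_mem_nhdsWithin] with s hs hst
  rw [slope_def_field, div_lt_iff₀ (sub_pos.2 hst)] at hs
  exact hs.le

end Excess

/-! ### Front tracking solutions -/

/-- A concatenation of front configurations as in `IsFrontTrackingSolution`, where the value near
`±∞` is an arbitrary constant `c` and the restarts need not be resolved by monotone fans. -/
def IsFrontSolution (F G : ℝ → ℝ) (c : ℝ) (u : ℝ → ℝ → ℝ) : Prop :=
  ∃ τ : ℕ → ℝ, τ 0 = 0 ∧ StrictMono τ ∧ Tendsto τ atTop atTop ∧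
    ∀ k : ℕ, ∃ (n : ℕ) (x w : ℕ → ℝ → ℝ),
      IsFrontFamily F G (τ k) (τ (k + 1)) n x w ∧
        (∀ t ∈ Icc (τ k) (τ (k + 1)), w 0 t = c ∧ w n t = c) ∧
        ∀ t ∈ Icc (τ k) (τ (k + 1)), u t = stepFunction n (fun i => x i t) (fun i => w i t)

lemma IsFrontTrackingSolution.isFrontSolution {ν : ℕ} {f g : ℝ → ℝ} {u : ℝ → ℝ → ℝ}
    (hfg : ∀ s, f s ≤ g s) (h : IsFrontTrackingSolution ν f g u) :
    IsFrontSolution (pwAffine ν f) (pwAffine ν g) 0 u := by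
  obtain ⟨τ, h0, hmono, hlim, hτ⟩ := h
  refine ⟨τ, h0, hmono, hlim, fun k => ?_⟩
  obtain ⟨n, x, w, hrun, hu⟩ := hτ k
  exact ⟨n, x, w, hrun.isFrontFamily (pwAffine_mono hfg ν) (hmono (Nat.lt_succ_self k)),
    fun t ht => ⟨hrun.left_zero t ht, hrun.right_zero t ht⟩, fun t ht => funext (hu t ht)⟩

lemma isFrontSolution_const {F G : ℝ → ℝ} (hFG : ∀ s, F s ≤ G s) (c : ℝ) :
    IsFrontSolution F G c (fun _ _ => c) :=
  ⟨fun k => k, by simp, Nat.strictMono_cast, tendsto_natCast_atTop_atTop, fun _ =>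
    ⟨0, _, _, isFrontFamily_const hFG _ _ c, fun _ _ => ⟨rfl, rfl⟩, fun _ _ => rfl⟩⟩

lemma exists_cell {τ : ℕ → ℝ} (h0 : τ 0 = 0) (hlim : Tendsto τ atTop atTop) {t : ℝ} (ht : 0 ≤ t) :
    ∃ k, t ∈ Icc (τ k) (τ (k + 1)) := by
  classical
  have hex : ∃ k, t ≤ τ (k + 1) :=
    (((tendsto_add_atTop_iff_nat 1).2 hlim).eventually_ge_atTop t).exists
  refine ⟨Nat.find hex, ?_, Nat.find_spec hex⟩
  rcases Nat.eq_zero_or_pos (Nat.find hex) with h | h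
  · rw [h, h0]; exact ht
  · have := Nat.find_min hex (Nat.sub_lt h one_pos)
    rw [Nat.sub_add_cancel (show 1 ≤ Nat.find hex from h)] at this
    exact (not_le.1 this).le

lemma eventually_stepFunction_eq {n : ℕ} {x w : ℕ → ℝ} (hx : ∀ i j, i ≤ j → j < n → x i ≤ x j)
    (ξ : ℝ) : ∀ᶠ η in 𝓝[>] ξ, stepFunction n x w η = stepFunction n x w ξ := by
  obtain ⟨k, hk, h1, h2⟩ := exists_plateau hx ξ
  have hlt : ∀ᶠ η in 𝓝[>] ξ, ∀ l ∈ Finset.Ico k n, η < x l :=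
    (eventually_all_finset _).2 fun l hl => nhdsWithin_le_nhds
      (eventually_lt_nhds (h2 l (Finset.mem_Ico.1 hl).1 (Finset.mem_Ico.1 hl).2))
  filter_upwards [hlt, self_mem_nhdsWithin] with η hη hξη
  rw [stepFunction_eq hk h1 h2, stepFunction_eq hk (fun l hl => (h1 l hl).trans (le_of_lt hξη))
    fun l hl hln => hη l (Finset.mem_Ico.2 ⟨hl, hln⟩)]

lemma forall_le_of_ae_le {p q : ℝ → ℝ} (hp : ∀ ξ, ∀ᶠ η in 𝓝[>] ξ, p η = p ξ)
    (hq : ∀ ξ, ∀ᶠ η in 𝓝[>] ξ, q η = q ξ) (h : ∀ᵐ ξ, p ξ ≤ q ξ) (ξ : ℝ) : p ξ ≤ q ξ := by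
  by_contra! hlt
  have hev : ∀ᶠ η in 𝓝[>] ξ, q η < p η := by
    filter_upwards [hp ξ, hq ξ] with η h1 h2
    rwa [h1, h2]
  obtain ⟨δ, hδ, hsub⟩ := mem_nhdsGT_iff_exists_Ioo_subset.1 hev
  have hnull : volume (Ioo ξ δ) = 0 :=
    measure_mono_null (fun η hη => not_le.2 (hsub hη)) (ae_iff.1 h)
  rw [Real.volume_Ioo, ENNReal.ofReal_eq_zero] at hnull
  have : ξ < δ := hδ
  linarith

section Contraction

variable {F G : ℝ → ℝ} {c c' : ℝ} {u v : ℝ → ℝ → ℝ}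

lemma IsFrontSolution.eventually_eq (hu : IsFrontSolution F G c u) {t : ℝ} (ht : 0 ≤ t) (ξ : ℝ) :
    ∀ᶠ η in 𝓝[>] ξ, u t η = u t ξ := by
  obtain ⟨τ, h0, _, hlim, hτ⟩ := hu
  obtain ⟨k, hk⟩ := exists_cell h0 hlim ht
  obtain ⟨n, x, w, hfam, _, hut⟩ := hτ k
  rw [hut t hk]
  exact eventually_stepFunction_eq (hfam.front_le t hk) ξ

lemma IsFrontSolution.integrable_excess (hu : IsFrontSolution F G c u)
    (hv : IsFrontSolution F G c' v) (hc : c ≤ c') {t : ℝ} (ht : 0 ≤ t) :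
    Integrable (fun ξ => max (u t ξ - v t ξ) 0) := by
  obtain ⟨τ, h0, _, hlim, hτ⟩ := hu
  obtain ⟨σ, h0', _, hlim', hσ⟩ := hv
  obtain ⟨k, hk⟩ := exists_cell h0 hlim ht
  obtain ⟨l, hl⟩ := exists_cell h0' hlim' ht
  obtain ⟨n, x, w, hfam, hw, hut⟩ := hτ k
  obtain ⟨m, y, z, hfam', hz, hvt⟩ := hσ l
  obtain ⟨S, -, hS⟩ := exists_isSortedShuffle n m _ _ (hfam.front_le t hk) (hfam'.front_le t hl)
  rw [hut t hk, hvt t hl]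
  refine (hS.integral_excess ?_ ?_).1
  · rwa [(hw t hk).1, (hz t hl).1]
  · rwa [(hw t hk).2, (hz t hl).2]

/-- The one-sided contraction property in `L¹`: both families of runs are restricted to the cells
of the common refinement of the two partitions of `[0, ∞)`. -/
theorem IsFrontSolution.antitoneOn_integral (hu : IsFrontSolution F G c u)
    (hv : IsFrontSolution F G c' v) (hc : c ≤ c') :
    AntitoneOn (fun t => ∫ ξ, max (u t ξ - v t ξ) 0) (Ici 0) := by
  obtain ⟨τ, h0, hmono, hlim, hτ⟩ := hu
  obtain ⟨σ, h0', hmono', hlim', hσ⟩ := hv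
  refine antitoneOn_of_partition hmono hlim (by rw [h0]) fun k => ?_
  rw [inter_eq_right.2 (show Icc (τ k) (τ (k + 1)) ⊆ Ici 0 from fun t ht =>
    (h0.symm.trans_le (hmono.monotone (Nat.zero_le k))).trans ht.1)]
  refine antitoneOn_of_partition hmono' hlim' (fun t ht => ?_) fun l => ?_
  · rw [h0', ← h0]
    exact (hmono.monotone (Nat.zero_le k)).trans ht.1
  obtain ⟨n, x, w, hfam, hw, hut⟩ := hτ k
  obtain ⟨m, y, z, hfam', hz, hvt⟩ := hσ l
  rw [Icc_inter_Icc]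
  have h1 : Icc (τ k ⊔ σ l) (τ (k + 1) ⊓ σ (l + 1)) ⊆ Icc (τ k) (τ (k + 1)) :=
    Icc_subset_Icc le_sup_left inf_le_left
  have h2 : Icc (τ k ⊔ σ l) (τ (k + 1) ⊓ σ (l + 1)) ⊆ Icc (σ l) (σ (l + 1)) :=
    Icc_subset_Icc le_sup_right inf_le_right
  refine (antitoneOn_excess (hfam.restrict le_sup_left inf_le_left)
    (hfam'.restrict le_sup_right inf_le_right) ?_ ?_).congr ?_
  · intro t ht
    rwa [(hw t (h1 ht)).1, (hz t (h2 ht)).1]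
  · intro t ht
    rwa [(hw t (h1 ht)).2, (hz t (h2 ht)).2]
  · intro t ht
    simp only [excess]
    rw [hut t (h1 ht), hvt t (h2 ht)]

/-- Comparison: if the excess of `u` over `v` vanishes once, then it vanishes at all later times,
and right-continuity turns the inequality almost everywhere into one at every point. -/
theorem IsFrontSolution.le_of_le (hu : IsFrontSolution F G c u)
    (hv : IsFrontSolution F G c' v) (hc : c ≤ c') {s t : ℝ} (hs : 0 ≤ s) (hst : s ≤ t)
    (h : ∀ ξ, u s ξ ≤ v s ξ) (ξ : ℝ) : u t ξ ≤ v t ξ := by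
  have ht := hs.trans hst
  have hanti := hu.antitoneOn_integral hv hc hs ht hst
  have hzero : ∫ ξ, max (u s ξ - v s ξ) 0 = 0 := by
    simp [fun ξ => max_eq_right (sub_nonpos.2 (h ξ))]
  simp only [hzero] at hanti
  have hnn : 0 ≤ fun ξ => max (u t ξ - v t ξ) 0 := fun ξ => le_max_right _ _
  have hae := (integral_eq_zero_iff_of_nonneg hnn (hu.integrable_excess hv hc ht)).1
    (le_antisymm hanti (integral_nonneg hnn))
  refine forall_le_of_ae_le (hu.eventually_eq ht) (hv.eventually_eq ht) ?_ ξ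
  filter_upwards [hae] with η hη
  exact sub_nonpos.1 (max_eq_right_iff.1 hη)

theorem IsFrontSolution.antitoneOn_eLpNorm_sub (hu : IsFrontSolution F G c u)
    (hv : IsFrontSolution F G c v) :
    AntitoneOn (fun t => eLpNorm (fun ξ => u t ξ - v t ξ) 1 volume) (Ici 0) := by
  refine AntitoneOn.congr (f₁ := fun t => ENNReal.ofReal
    ((∫ ξ, max (u t ξ - v t ξ) 0) + ∫ ξ, max (v t ξ - u t ξ) 0)) ?_ ?_
  · intro s hs t ht hst
    exact ENNReal.ofReal_le_ofReal (add_le_add (hu.antitoneOn_integral hv le_rfl hs ht hst)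
      (hv.antitoneOn_integral hu le_rfl hs ht hst))
  · intro t ht
    have i1 := hu.integrable_excess hv le_rfl ht
    have i2 := hv.integrable_excess hu le_rfl ht
    have hnorm : ∀ ξ, ‖u t ξ - v t ξ‖ = max (u t ξ - v t ξ) 0 + max (v t ξ - u t ξ) 0 := by
      intro ξ
      rw [Real.norm_eq_abs]
      rcases le_total (u t ξ) (v t ξ) with h | h
      · rw [abs_of_nonpos (by linarith), max_eq_right (by linarith), max_eq_left (by linarith)]
        ring
      · rw [abs_of_nonneg (by linarith), max_eq_left (by linarith), max_eq_right (by linarith)]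
        ring
    have hint : Integrable fun ξ => u t ξ - v t ξ := by
      refine (i1.sub i2).congr (Eventually.of_forall fun ξ => ?_)
      change max (u t ξ - v t ξ) 0 - max (v t ξ - u t ξ) 0 = u t ξ - v t ξ
      rcases le_total (u t ξ) (v t ξ) with h | h
      · rw [max_eq_right (by linarith), max_eq_left (by linarith)]; ring
      · rw [max_eq_left (by linarith), max_eq_right (by linarith)]; ring
    simp only
    rw [← integral_add i1 i2, eLpNorm_one_eq_lintegral_enorm,
      ← ofReal_integral_norm_eq_lintegral_enorm hint]
    simp only [hnorm]

theorem IsFrontSolution.antitoneOn_eLpNorm_top (hFG : ∀ s, F s ≤ G s)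
    (hu : IsFrontSolution F G 0 u) :
    AntitoneOn (fun t => eLpNorm (u t) ⊤ volume) (Ici 0) := by
  intro s hs t ht hst
  simp only [eLpNorm_exponent_top]
  rcases eq_or_ne (eLpNormEssSup (u s) volume) ⊤ with htop | htop
  · rw [htop]; exact le_top
  set M := (eLpNormEssSup (u s) volume).toReal with hM
  have hM0 : 0 ≤ M := ENNReal.toReal_nonneg
  have hbound : ∀ᵐ ξ, |u s ξ| ≤ M := by
    filter_upwards [ae_le_eLpNormEssSup (f := u s) (μ := volume)] with ξ hξ
    have := ENNReal.toReal_mono htop hξ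
    rwa [toReal_enorm, Real.norm_eq_abs] at this
  have hconst : ∀ (r ξ : ℝ), ∀ᶠ η in 𝓝[>] ξ, (fun _ : ℝ => r) η = (fun _ : ℝ => r) ξ :=
    fun r ξ => Eventually.of_forall fun _ => rfl
  have hup := hu.le_of_le (isFrontSolution_const hFG M) hM0 hs hst
    (forall_le_of_ae_le (hu.eventually_eq hs) (hconst M)
      (hbound.mono fun ξ hξ => (abs_le.1 hξ).2))
  have hlow := (isFrontSolution_const hFG (-M)).le_of_le hu (neg_nonpos.2 hM0) hs hst
    (forall_le_of_ae_le (hconst (-M)) (hu.eventually_eq hs)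
      (hbound.mono fun ξ hξ => (abs_le.1 hξ).1))
  refine (eLpNormEssSup_le_of_ae_bound (C := M)
    (Eventually.of_forall fun ξ => abs_le.2 ⟨hlow ξ, hup ξ⟩)).trans_eq ?_
  rw [hM, ENNReal.ofReal_toReal htop]

end Contraction

/-! ### Total variation -/

section Variation

variable {n : ℕ} {x w : ℕ → ℝ}

lemma eVariationOn_stepFunction_le :
    eVariationOn (stepFunction n x w) univ ≤
      ENNReal.ofReal (∑ i ∈ Finset.range n, |w (i + 1) - w i|) := by
  set P : ℕ → ℝ := fun k => ∑ i ∈ Finset.range k, |w (i + 1) - w i| with hP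
  have hPmono : Monotone P := monotone_nat_of_le_succ fun k => by
    simp only [hP, Finset.sum_range_succ]
    linarith [abs_nonneg (w (k + 1) - w k)]
  have hdist : ∀ i j, i ≤ j → |w j - w i| ≤ P j - P i := by
    intro i j hij
    rw [hP, ← Finset.sum_Ico_eq_sub _ hij, ← Finset.sum_Ico_sub w hij]
    exact Finset.abs_sum_le_sum_abs _ _
  have hcard : Monotone fun ξ : ℝ => ((Finset.range n).filter (fun i => x i ≤ ξ)).card :=
    fun ξ η h => Finset.card_le_card (Finset.monotone_filter_right _ fun i _ hi => hi.trans h)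
  calc eVariationOn (stepFunction n x w) univ
      ≤ eVariationOn w (Icc 0 n) := by
        refine eVariationOn.comp_le_of_monotoneOn w _ (hcard.monotoneOn _) fun ξ _ => ?_
        exact ⟨Nat.zero_le _, (Finset.card_filter_le _ _).trans_eq (Finset.card_range n)⟩
    _ ≤ eVariationOn P (Icc 0 n) := by
        refine iSup_mono fun p => Finset.sum_le_sum fun i _ => ?_
        have hp := p.2.2.1 (Nat.le_succ i)
        rw [edist_dist, edist_dist, Real.dist_eq, Real.dist_eq]
        exact ENNReal.ofReal_le_ofReal ((hdist _ _ hp).trans (le_abs_self _))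
    _ ≤ ENNReal.ofReal (P n - P 0) := by
        simpa using ((hPmono.monotoneOn (univ : Set ℕ)).eVariationOn_eq (mem_univ 0)
          (mem_univ n)).le
    _ = _ := by simp [hP]

lemma eVariationOn_Iic_add_le (p : ℝ → ℝ) {ξ η : ℝ} (h : ξ ≤ η) :
    eVariationOn p (Iic ξ) + ENNReal.ofReal |p η - p ξ| ≤ eVariationOn p (Iic η) := by
  have h1 : ENNReal.ofReal |p η - p ξ| ≤ eVariationOn p (Icc ξ η) := by
    rw [← Real.dist_eq, ← edist_dist]
    exact eVariationOn.edist_le p (right_mem_Icc.2 h) (left_mem_Icc.2 h)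
  refine (add_le_add_right h1 _).trans ((eVariationOn.add_le_union p fun s hs t ht =>
    (mem_Iic.1 hs).trans ht.1).trans (eVariationOn.mono p ?_))
  exact union_subset (Iic_subset_Iic.2 h) Icc_subset_Iic_self

/-- The jumps of a step function do not exceed its total variation, even when several fronts
coincide, provided that the states between coinciding fronts are monotone. -/
lemma le_eVariationOn_stepFunction (hx : ∀ i j, i ≤ j → j < n → x i ≤ x j)
    (hfan : ∀ i, i + 1 < n → x i = x (i + 1) →
      (w i < w (i + 1) ∧ w (i + 1) < w (i + 2)) ∨ (w (i + 2) < w (i + 1) ∧ w (i + 1) < w i)) :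
    ENNReal.ofReal (∑ i ∈ Finset.range n, |w (i + 1) - w i|) ≤
      eVariationOn (stepFunction n x w) univ := by
  set p := stepFunction n x w with hp
  -- `ξ` lies on the last visible plateau before the fan to which the front `x k` belongs.
  have key : ∀ k < n, ∃ ξ < x k,
      ENNReal.ofReal (∑ i ∈ Finset.range (k + 1), |w (i + 1) - w i|) ≤
        eVariationOn p (Iic ξ) + ENNReal.ofReal |w (k + 1) - p ξ| ∧
      (w k < w (k + 1) → p ξ ≤ w k) ∧ (w (k + 1) < w k → w k ≤ p ξ) := by
    intro k
    induction k with
    | zero =>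
      intro hk
      have hpx : p (x 0 - 1) = w 0 := stepFunction_eq (Nat.zero_le n) (by simp) fun l _ hl =>
        (sub_one_lt (x 0)).trans_le (hx 0 l (Nat.zero_le l) hl)
      refine ⟨x 0 - 1, sub_one_lt _, ?_, fun _ => hpx.le, fun _ => hpx.ge⟩
      rw [hpx]
      simp
    | succ k ih =>
      intro hk
      obtain ⟨ξ, hξ, hsum, hup, hdown⟩ := ih (by omega)
      rw [Finset.sum_range_succ, ENNReal.ofReal_add (Finset.sum_nonneg fun _ _ => abs_nonneg _)
        (abs_nonneg _)]
      rcases (hx k (k + 1) (Nat.le_succ k) hk).eq_or_lt with heq | hlt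
      · refine ⟨ξ, hξ.trans_eq heq, ?_, ?_, ?_⟩
        · refine (add_le_add_left hsum _).trans ?_
          rw [add_assoc, ← ENNReal.ofReal_add (abs_nonneg _) (abs_nonneg _)]
          refine add_le_add_right (ENNReal.ofReal_le_ofReal (le_of_eq ?_)) _
          rcases hfan k hk heq with ⟨h1, h2⟩ | ⟨h1, h2⟩
          · have := hup h1
            rw [abs_of_nonneg (by linarith), abs_of_nonneg (by linarith),
              abs_of_nonneg (by linarith)]
            ring
          · have := hdown h2
            rw [abs_of_nonpos (by linarith), abs_of_nonpos (by linarith),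
              abs_of_nonpos (by linarith)]
            ring
        · intro h
          rcases hfan k hk heq with ⟨h1, h2⟩ | ⟨h1, h2⟩
          · exact (hup h1).trans h1.le
          · exact absurd h h1.le.not_gt
        · intro h
          rcases hfan k hk heq with ⟨h1, h2⟩ | ⟨h1, h2⟩
          · exact absurd h h2.le.not_gt
          · exact h2.le.trans (hdown h2)
      · have hpx : p (x k) = w (k + 1) := stepFunction_eq hk.le
          (fun l hl => hx l k (by omega) (by omega))
          (fun l hl hln => hlt.trans_le (hx _ _ hl hln))
        refine ⟨x k, hlt, ?_, fun _ => hpx.le, fun _ => hpx.ge⟩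
        rw [hpx]
        refine add_le_add_left (hsum.trans ?_) _
        rw [← hpx]
        exact eVariationOn_Iic_add_le p hξ.le
  rcases Nat.eq_zero_or_pos n with rfl | hn
  · simp
  obtain ⟨n, rfl⟩ : ∃ n', n = n' + 1 := ⟨n - 1, by omega⟩
  obtain ⟨ξ, hξ, hsum, -⟩ := key n (by omega)
  have hpx : p (x n) = w (n + 1) := stepFunction_eq le_rfl
    (fun l hl => hx l n (by omega) (by omega)) (fun l hl hln => by omega)
  rw [← hpx] at hsum
  exact hsum.trans ((eVariationOn_Iic_add_le p hξ.le).trans (eVariationOn.mono p (subset_univ _)))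

end Variation

section Run

variable {F G : ℝ → ℝ} {a b : ℝ} {n : ℕ} {x w : ℕ → ℝ → ℝ}

/-- The plateaus at local extrema move towards the neighbouring states, the others do not move. -/
lemma sign_sub_sign_mul_plateauRate_nonpos (hFG : ∀ s, F s ≤ G s) {l p r len : ℝ} (hl : l ≠ p)
    (hr : p ≠ r) (hlen : 0 < len) :
    ((SignType.sign (p - l) : ℝ) - (SignType.sign (r - p) : ℝ)) *
      plateauRate F G l p r len ≤ 0 := by
  have hrate : (F p - G p) / len ≤ 0 := div_nonpos_of_nonpos_of_nonneg (by linarith [hFG p]) hlen.le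
  have hrate' : 0 ≤ (G p - F p) / len := div_nonneg (by linarith [hFG p]) hlen.le
  unfold plateauRate
  rcases lt_or_gt_of_ne hl with h1 | h1 <;> rcases lt_or_gt_of_ne hr with h2 | h2
  · rw [sign_pos (sub_pos.2 h1), sign_pos (sub_pos.2 h2)]; simp
  · rw [sign_pos (sub_pos.2 h1), sign_neg (sub_neg.2 h2), if_pos (max_lt h1 h2)]
    norm_num
    linarith
  · rw [sign_neg (sub_neg.2 h1), sign_pos (sub_pos.2 h2), if_neg (by simp [h2.le]),
      if_pos (lt_min h1 h2)]
    norm_num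
    linarith
  · rw [sign_neg (sub_neg.2 h1), sign_neg (sub_neg.2 h2)]; simp

lemma IsFrontRun.antitoneOn_jumps (hFG : ∀ s, F s ≤ G s) (h : IsFrontRun F G a b n x w) :
    AntitoneOn (fun t => ∑ i ∈ Finset.range n, |w (i + 1) t - w i t|) (Icc a b) := by
  have hder : ∀ t ∈ Ioo a b, ∃ d ≤ 0,
      HasDerivAt (fun t => ∑ i ∈ Finset.range n, |w (i + 1) t - w i t|) d t := by
    intro t ht
    obtain ⟨wd, hd0, hdn, hd, hrate⟩ := h.hasDerivAt_state ht
    have hne : ∀ i < n, w i t ≠ w (i + 1) t := fun i hi => h.jump_ne i hi t ⟨ht.1.le, ht.2⟩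
    refine ⟨∑ i ∈ Finset.range n,
      (SignType.sign (w (i + 1) t - w i t) : ℝ) * (wd (i + 1) - wd i), ?_, ?_⟩
    -- Summation by parts: the state `w (k + 1)` enters with the factor `sign_k - sign_(k+1)`.
    · have key : ∀ k < n, ∑ i ∈ Finset.range (k + 1),
          (SignType.sign (w (i + 1) t - w i t) : ℝ) * (wd (i + 1) - wd i) ≤
            (SignType.sign (w (k + 1) t - w k t) : ℝ) * wd (k + 1) := by
        intro k
        induction k with
        | zero => intro _; simp [hd0]
        | succ k ih =>
          intro hk
          rw [Finset.sum_range_succ]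
          have h1 := ih (by omega)
          have h2 := sign_sub_sign_mul_plateauRate_nonpos hFG (hne k (by omega)) (hne (k + 1) hk)
            (sub_pos.2 (h.front_lt k hk t ht))
          rw [← hrate k hk] at h2
          linarith
      rcases Nat.eq_zero_or_pos n with rfl | hn
      · simp
      · have := key (n - 1) (by omega)
        rwa [Nat.sub_add_cancel hn, hdn, mul_zero] at this
    · refine HasDerivAt.fun_sum fun i hi => ?_
      have hi := Finset.mem_range.1 hi
      exact (hasDerivAt_abs (sub_ne_zero.2 (hne i hi).symm)).comp t
        ((hd (i + 1) hi).sub (hd i hi.le))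
  refine antitoneOn_of_deriv_nonpos (convex_Icc a b) ?_ ?_ ?_
  · refine continuousOn_finsetSum _ fun i hi => ?_
    have hi := Finset.mem_range.1 hi
    exact ((h.cont_state (i + 1) hi).sub (h.cont_state i hi.le)).abs
  · rw [interior_Icc]
    intro t ht
    obtain ⟨d, -, hd⟩ := hder t ht
    exact hd.differentiableAt.differentiableWithinAt
  · rw [interior_Icc]
    intro t ht
    obtain ⟨d, hd0, hd⟩ := hder t ht
    rwa [hd.deriv]

theorem IsFrontTrackingSolution.antitoneOn_eVariationOn {ν : ℕ} {f g : ℝ → ℝ} {u : ℝ → ℝ → ℝ}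
    (hfg : ∀ s, f s ≤ g s) (h : IsFrontTrackingSolution ν f g u) :
    AntitoneOn (fun t => eVariationOn (u t) univ) (Ici 0) := by
  obtain ⟨τ, h0, hmono, hlim, hτ⟩ := h
  refine antitoneOn_of_partition hmono hlim (by rw [h0]) fun k => ?_
  obtain ⟨n, x, w, hrun, hu⟩ := hτ k
  have hlt := hmono (Nat.lt_succ_self k)
  rintro s ⟨-, hs⟩ t ⟨-, ht⟩ hst
  rcases hst.eq_or_lt with rfl | hst'
  · exact le_rfl
  simp only
  rw [show u t = _ from funext (hu t ht), show u s = _ from funext (hu s hs)]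
  refine eVariationOn_stepFunction_le.trans ((ENNReal.ofReal_le_ofReal
    (hrun.antitoneOn_jumps (pwAffine_mono hfg ν) hs ht hst)).trans
      (le_eVariationOn_stepFunction (hrun.front_le hlt hs) fun i hi hxx => ?_))
  rcases hs.1.eq_or_lt with rfl | hs'
  · exact hrun.fan i hi hxx
  · exact absurd hxx (hrun.front_lt i hi s ⟨hs', hst'.trans_le ht.2⟩).ne

end Run

end FrontTracking

theorem proposition2p1 (f g : ℝ → ℝ) (hf : ContDiff ℝ 2 f) (hg : ContDiff ℝ 2 g)
    (c₀ : ℝ) (hc₀ : 0 < c₀) (hfg : ∀ s : ℝ, c₀ ≤ g s - f s)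
    (ν : ℕ) (hν : 1 ≤ ν) (u v : ℝ → ℝ → ℝ)
    (hu : FrontTracking.IsFrontTrackingSolution ν f g u)
    (hv : FrontTracking.IsFrontTrackingSolution ν f g v) :
    AntitoneOn (fun t => MeasureTheory.eLpNorm (u t) 1 MeasureTheory.volume) (Set.Ici 0) ∧
    AntitoneOn (fun t => eVariationOn (u t) Set.univ) (Set.Ici 0) ∧
    AntitoneOn (fun t => MeasureTheory.eLpNorm (u t) ⊤ MeasureTheory.volume) (Set.Ici 0) ∧
    ((∀ x, u 0 x ≤ v 0 x) → ∀ t, 0 ≤ t → ∀ x, u t x ≤ v t x) ∧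
    AntitoneOn (fun t => MeasureTheory.eLpNorm (fun x => u t x - v t x) 1 MeasureTheory.volume)
      (Set.Ici 0) ∧
    (∀ t, 0 < t →
      MeasureTheory.eLpNorm (fun x => u t x - v t x) 1 MeasureTheory.volume ≤
        MeasureTheory.eLpNorm (fun x => u 0 x - v 0 x) 1 MeasureTheory.volume) := by
  have hle : ∀ s, f s ≤ g s := fun s => by linarith [hfg s]
  have hFG := FrontTracking.pwAffine_mono hle ν
  have hu' := hu.isFrontSolution hle
  have hv' := hv.isFrontSolution hle
  have hcontr := hu'.antitoneOn_eLpNorm_sub hv'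
  refine ⟨?_, hu.antitoneOn_eVariationOn hle, hu'.antitoneOn_eLpNorm_top hFG,
    fun h t ht => hu'.le_of_le hv' le_rfl le_rfl ht h, hcontr,
    fun t ht => hcontr Set.self_mem_Ici ht.le ht.le⟩
  simpa using hu'.antitoneOn_eLpNorm_sub (FrontTracking.isFrontSolution_const hFG 0)
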